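/- Let $m\ge 0$, let $A:\mathbb C^m\to\mathbb C^m$ be linear with operator norm $\|A\|<1$ (with respect to the Euclidean norm), let $b\in\mathbb C^m$, and let $\varphi:\mathbb C^m\to\mathbb C$ be an entire function with $|\varphi(z)|\le c\,e^{a\|z\|}$ for all $z\in\mathbb C^m$ and some constants $a,c\in\mathbb R$. Put $(Tf)(z)=\varphi(z)\,f(Az+b)$. Let $\mathcal F(\mathbb C^m)$ be the Bargmann–Fock space, i.e. the Hilbert space of entire functions $f$ on $\mathbb C^m$ with $\|f\|^2=\int_{\mathbb C^m}|f(z)|^2e^{-\pi\|z\|^2}\,dz<\infty$, where $dz$ is Lebesgue measure. For an open bounded $U\subset\mathbb C^m$ let $A^\infty(U)$ be the Banach space, with the supremum norm, of the continuous functions on $\overline U$ that are holomorphic on $U$. Let $B(0,r)=\{z\in\mathbb C^m:\|z\|<r\}$. Then $T$ is a bounded operator $\mathcal F(\mathbb C^m)\to\mathcal F(\mathbb C^m)$ and is trace class (that is, $\sum_i\langle |T|e_i,e_i\rangle<\infty$ for every orthonormal basis $(e_i)$, where $|T|=(T^*T)^{1/2}$). Moreover, for every $r>\frac{\|b\|}{1-\|A\|}$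 the map $z\mapsto Az+b$ sends $\overline{B(0,r)}$ into $B(0,r)$, and $T$ is a bounded operator $A^\infty(B(0,r))\to A^\infty(B(0,r))$ that is nuclear of order zero (that is, for every $p>0$ it can be written as $Tf=\sum_n c_n\,\ell_n(f)\,v_n$ with functionals $\|\ell_n\|\le1$, vectors $\|v_n\|\le 1$ and $\sum_n|c_n|^p<\infty$). Its traces are $$\operatorname{trace}_{\mathcal F(\mathbb C^m)}T=\operatorname{trace}_{A^\infty(B(0,r))}T=\frac{\varphi\big((1-A)^{-1}b\big)}{\det(1-A)} .$$ Here $\operatorname{trace}_{\mathcal F(\mathbb C^m)}T=\sum_i\langle Te_i,e_i\rangle$ for any orthonormal basis $(e_i)$, and $\operatorname{trace}_{A^\infty(B(0,r))}T=\sum_n c_n\,\ell_n(v_n)$ for any representation as above with $\sum_n|c_n|<\infty$; both sums are independent of the choices. -/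

import Mathlib

open MeasureTheory Metric Filter Topology

/-- The Hermitian space `ℂᵐ`, with the Euclidean norm. -/
abbrev Cn (m : ℕ) : Type := EuclideanSpace ℂ (Fin m)

section FockSpace

variable {m : ℕ}

/-- The entire functions `f` on `ℂᵐ` with `∫ |f(z)|² exp(-π‖z‖²) dz < ∞`. -/
def fockSubmodule (m : ℕ) : Submodule ℂ (Cn m → ℂ) where
  carrier := {f | Differentiable ℂ f ∧
    Integrable (fun z : Cn m => ‖f z‖ ^ 2 * Real.exp (-Real.pi * ‖z‖ ^ 2)) volume}
  zero_mem' := by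
    refine ⟨differentiable_const (0 : ℂ), ?_⟩
    simp
  add_mem' := by
    rintro f g ⟨hf, hf2⟩ ⟨hg, hg2⟩
    refine ⟨hf.add hg, ((hf2.add hg2).const_mul 2).mono' ?_ (ae_of_all _ fun z => ?_)⟩
    · have h := (hf.add hg).continuous
      exact Continuous.aestronglyMeasurable ((h.norm.pow 2).mul (by fun_prop))
    · have h1 : ‖(f + g) z‖ ^ 2 ≤ 2 * (‖f z‖ ^ 2 + ‖g z‖ ^ 2) := by
        have h2 : ‖(f + g) z‖ ≤ ‖f z‖ + ‖g z‖ := norm_add_le _ _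
        nlinarith [sq_nonneg (‖f z‖ - ‖g z‖), norm_nonneg ((f + g) z)]
      rw [Real.norm_of_nonneg (by positivity)]
      simp only [Pi.add_apply] at h1 ⊢
      nlinarith [mul_le_mul_of_nonneg_right h1 (Real.exp_pos (-Real.pi * ‖z‖ ^ 2)).le]
  smul_mem' := by
    rintro c f ⟨hf, hf2⟩
    refine ⟨hf.const_smul c, (hf2.const_mul (‖c‖ ^ 2)).congr (ae_of_all _ fun z => ?_)⟩
    simp only [Pi.smul_apply, smul_eq_mul, norm_mul]
    ring

/-- The Bargmann–Fock space `F(ℂᵐ)`. -/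
def BargmannFock (m : ℕ) : Type := fockSubmodule m

namespace BargmannFock

noncomputable instance : AddCommGroup (BargmannFock m) :=
  inferInstanceAs (AddCommGroup (fockSubmodule m))

noncomputable instance : Module ℂ (BargmannFock m) :=
  inferInstanceAs (Module ℂ (fockSubmodule m))

instance : FunLike (BargmannFock m) (Cn m) ℂ where
  coe f := f.1
  coe_injective _ _ h := Subtype.ext h

@[simp] theorem add_apply (f g : BargmannFock m) (z : Cn m) : (f + g) z = f z + g z := rfl

@[simp] theorem sub_apply (f g : BargmannFock m) (z : Cn m) : (f - g) z = f z - g z := rfl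

@[simp] theorem smul_apply (c : ℂ) (f : BargmannFock m) (z : Cn m) : (c • f) z = c * f z := rfl

theorem differentiable (f : BargmannFock m) : Differentiable ℂ f := f.2.1

theorem integrable_sq (f : BargmannFock m) :
    Integrable (fun z : Cn m => ‖f z‖ ^ 2 * Real.exp (-Real.pi * ‖z‖ ^ 2)) volume := f.2.2

theorem continuous (f : BargmannFock m) : Continuous f := f.differentiable.continuous

theorem integrable_inner (f g : BargmannFock m) :
    Integrable (fun z : Cn m =>
      starRingEnd ℂ (f z) * g z * (Real.exp (-Real.pi * ‖z‖ ^ 2) : ℂ)) volume := by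
  refine (f.integrable_sq.add g.integrable_sq).mono' ?_ (ae_of_all _ fun z => ?_)
  · have := f.continuous
    have := g.continuous
    exact Continuous.aestronglyMeasurable (by fun_prop)
  · rw [norm_mul, norm_mul, RCLike.norm_conj, Complex.norm_real,
      Real.norm_of_nonneg (Real.exp_pos _).le]
    have := Real.exp_pos (-Real.pi * ‖z‖ ^ 2)
    simp only [Pi.add_apply]
    rw [← add_mul]
    refine mul_le_mul_of_nonneg_right ?_ this.le
    nlinarith [sq_nonneg (‖f z‖ - ‖g z‖), sq_nonneg (‖f z‖), sq_nonneg (‖g z‖)]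

theorem inner_self_integral (f : BargmannFock m) :
    ∫ z : Cn m, starRingEnd ℂ (f z) * f z * (Real.exp (-Real.pi * ‖z‖ ^ 2) : ℂ) =
      ((∫ z : Cn m, ‖f z‖ ^ 2 * Real.exp (-Real.pi * ‖z‖ ^ 2) : ℝ) : ℂ) := by
  rw [← integral_complex_ofReal]
  refine integral_congr_ae (ae_of_all _ fun z => ?_)
  simp only [Complex.conj_mul']
  push_cast
  ring

/-- The inner product `⟪f, g⟫ = ∫ conj(f(z)) g(z) exp(-π‖z‖²) dz`. -/
@[reducible] noncomputable def core (m : ℕ) : InnerProductSpace.Core ℂ (BargmannFock m) where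
  inner f g := ∫ z : Cn m, starRingEnd ℂ (f z) * g z * (Real.exp (-Real.pi * ‖z‖ ^ 2) : ℂ)
  conj_inner_symm f g := by
    rw [← integral_conj]
    refine integral_congr_ae (ae_of_all _ fun z => ?_)
    simp only [map_mul, Complex.conj_conj, Complex.conj_ofReal]
    ring
  re_inner_nonneg f := by
    rw [inner_self_integral]
    exact integral_nonneg fun z => by positivity
  add_left f g h := by
    rw [← integral_add (f.integrable_inner h) (g.integrable_inner h)]
    refine integral_congr_ae (ae_of_all _ fun z => ?_)
    simp only [add_apply, map_add]
    ring
  smul_left f g c := by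
    rw [← integral_const_mul]
    refine integral_congr_ae (ae_of_all _ fun z => ?_)
    simp only [smul_apply, map_mul]
    ring
  definite f hf := by
    rw [inner_self_integral, Complex.ofReal_eq_zero,
      integral_eq_zero_iff_of_nonneg (fun z => by positivity) f.integrable_sq] at hf
    have hc : Continuous fun z : Cn m => ‖f z‖ ^ 2 * Real.exp (-Real.pi * ‖z‖ ^ 2) := by
      have := f.continuous
      fun_prop
    have h0 := (hc.ae_eq_iff_eq volume continuous_zero).1 hf
    refine DFunLike.ext _ _ fun z => ?_
    have h1 : f z = 0 := by simpa [(Real.exp_pos _).ne'] using congrFun h0 z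
    exact h1

noncomputable instance : NormedAddCommGroup (BargmannFock m) :=
  (core m).toNormedAddCommGroup

noncomputable instance : InnerProductSpace ℂ (BargmannFock m) :=
  InnerProductSpace.ofCore (core m).toCore

theorem inner_def (f g : BargmannFock m) :
    inner ℂ f g =
      ∫ z : Cn m, starRingEnd ℂ (f z) * g z * (Real.exp (-Real.pi * ‖z‖ ^ 2) : ℂ) := rfl

theorem norm_sq_eq (f : BargmannFock m) :
    ‖f‖ ^ 2 = ∫ z : Cn m, ‖f z‖ ^ 2 * Real.exp (-Real.pi * ‖z‖ ^ 2) := by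
  have h : ((‖f‖ ^ 2 : ℝ) : ℂ) = inner ℂ f f := by
    rw [inner_self_eq_norm_sq_to_K]; simp
  rw [inner_def, inner_self_integral] at h
  exact_mod_cast h

/-- The mean value property on balls. -/
theorem mean_value {g : Cn m → ℂ} (hg : Differentiable ℂ g) (z : Cn m) :
    ∫ y in ball (0 : Cn m) 1, g (z + y) = (volume.real (ball (0 : Cn m) 1) : ℂ) * g z := by
  have hgc := hg.continuous
  have hrot : ∀ θ : ℝ, ∫ y in ball (0 : Cn m) 1, g (z + Complex.exp (θ * Complex.I) • y) =
      ∫ y in ball (0 : Cn m) 1, g (z + y) := by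
    intro θ
    let L : Cn m ≃ₗᵢ[ℝ] Cn m :=
      { toFun := fun y => Complex.exp (θ * Complex.I) • y
        invFun := fun y => Complex.exp (-(θ * Complex.I)) • y
        map_add' := fun x y => smul_add _ _ _
        map_smul' := fun r x => smul_comm _ _ _
        left_inv := fun x => by simp [smul_smul, ← Complex.exp_add]
        right_inv := fun x => by simp [smul_smul, ← Complex.exp_add]
        norm_map' := fun x => by
          change ‖Complex.exp (θ * Complex.I) • x‖ = ‖x‖
          rw [norm_smul, Complex.norm_exp_ofReal_mul_I, one_mul] }
    have := (L.measurePreserving).setIntegral_preimage_emb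
      L.toHomeomorph.measurableEmbedding (fun y => g (z + y)) (ball 0 1)
    have hpre : L ⁻¹' ball (0 : Cn m) 1 = ball 0 1 := by
      ext y; simp
    rw [hpre] at this
    exact this
  have hcirc : ∀ y : Cn m,
      ∫ θ in (0 : ℝ)..2 * Real.pi, g (z + Complex.exp (θ * Complex.I) • y) =
        2 * Real.pi * g z := by
    intro y
    have h := DiffContOnCl.circleAverage (f := fun t : ℂ => g (z + t • y)) (c := 0) (R := 1)
      (Differentiable.diffContOnCl (by fun_prop))
    simp only [Real.circleAverage, circleMap, zero_add, Complex.ofReal_one, one_mul,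
      zero_smul, add_zero] at h
    rw [← h, Complex.real_smul, ← mul_assoc]
    push_cast
    rw [mul_inv_cancel₀ (by exact_mod_cast (by positivity : (2 * Real.pi : ℝ) ≠ 0)), one_mul]
  have hswap : ∫ θ in (0 : ℝ)..2 * Real.pi, ∫ y in ball (0 : Cn m) 1,
        g (z + Complex.exp (θ * Complex.I) • y) =
      ∫ y in ball (0 : Cn m) 1, ∫ θ in (0 : ℝ)..2 * Real.pi,
        g (z + Complex.exp (θ * Complex.I) • y) := by
    refine intervalIntegral_integral_swap ?_
    rw [Set.uIoc_of_le (by positivity), Measure.prod_restrict]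
    have : ContinuousOn (Function.uncurry fun (θ : ℝ) (y : Cn m) =>
        g (z + Complex.exp (θ * Complex.I) • y))
        (Set.Icc 0 (2 * Real.pi) ×ˢ closedBall 0 1) := by
      apply Continuous.continuousOn
      fun_prop
    exact (this.integrableOn_compact (isCompact_Icc.prod (isCompact_closedBall _ _))).mono_set
      (Set.prod_mono Set.Ioc_subset_Icc_self ball_subset_closedBall)
  simp only [hrot, hcirc] at hswap
  rw [intervalIntegral.integral_const, setIntegral_const, sub_zero, Complex.real_smul,
    Complex.real_smul] at hswap
  have hpi : ((2 * Real.pi : ℝ) : ℂ) ≠ 0 := by exact_mod_cast (by positivity)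
  apply mul_left_cancel₀ hpi
  rw [hswap]
  push_cast
  ring

/-- Point evaluations are bounded, uniformly on bounded sets. -/
theorem exists_norm_apply_le (m : ℕ) (R : ℝ) :
    ∃ C : ℝ, 0 ≤ C ∧ ∀ (f : BargmannFock m) (z : Cn m), ‖z‖ ≤ R → ‖f z‖ ^ 2 ≤ C * ‖f‖ ^ 2 := by
  have hV : 0 < volume.real (ball (0 : Cn m) 1) :=
    ENNReal.toReal_pos (measure_ball_pos _ _ one_pos).ne' measure_ball_lt_top.ne
  set V := volume.real (ball (0 : Cn m) 1) with hVdef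
  refine ⟨V⁻¹ * Real.exp (Real.pi * (R + 1) ^ 2), by positivity, fun f z hz => ?_⟩
  have hR : 0 ≤ R := (norm_nonneg z).trans hz
  have hmv := mean_value (f.differentiable.pow 2) z
  have hfc := f.continuous
  have h1 : V * ‖f z‖ ^ 2 ≤ ∫ y in ball (0 : Cn m) 1, ‖f (z + y)‖ ^ 2 := by
    calc V * ‖f z‖ ^ 2 = ‖((V : ℝ) : ℂ) * (f z) ^ 2‖ := by
          rw [norm_mul, norm_pow, Complex.norm_real, Real.norm_of_nonneg hV.le]
      _ = ‖∫ y in ball (0 : Cn m) 1, (f (z + y)) ^ 2‖ := by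
          rw [show (∫ y in ball (0 : Cn m) 1, (f (z + y)) ^ 2) = _ from hmv]; rfl
      _ ≤ ∫ y in ball (0 : Cn m) 1, ‖(f (z + y)) ^ 2‖ := norm_integral_le_integral_norm _
      _ = _ := by simp only [norm_pow]
  have hint : Integrable (fun y : Cn m => ‖f (z + y)‖ ^ 2 *
      Real.exp (-Real.pi * ‖z + y‖ ^ 2)) volume := f.integrable_sq.comp_add_left z
  have h2 : ∫ y in ball (0 : Cn m) 1, ‖f (z + y)‖ ^ 2 ≤
      ∫ y in ball (0 : Cn m) 1, Real.exp (Real.pi * (R + 1) ^ 2) * (‖f (z + y)‖ ^ 2 *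
        Real.exp (-Real.pi * ‖z + y‖ ^ 2)) := by
    refine setIntegral_mono_on ?_ (hint.const_mul _).integrableOn measurableSet_ball ?_
    · exact (ContinuousOn.integrableOn_compact (isCompact_closedBall (0 : Cn m) 1)
        (by fun_prop)).mono_set ball_subset_closedBall
    · intro y hy
      have hy1 : ‖y‖ ≤ 1 := by simpa using (mem_ball_zero_iff.1 hy).le
      have hzy : ‖z + y‖ ≤ R + 1 := (norm_add_le _ _).trans (add_le_add hz hy1)
      have h3 : ‖z + y‖ ^ 2 ≤ (R + 1) ^ 2 := by gcongr
      have h4 : 1 ≤ Real.exp (Real.pi * (R + 1) ^ 2) * Real.exp (-Real.pi * ‖z + y‖ ^ 2) := by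
        rw [← Real.exp_add]
        refine Real.one_le_exp ?_
        nlinarith [Real.pi_pos]
      calc ‖f (z + y)‖ ^ 2 = ‖f (z + y)‖ ^ 2 * 1 := (mul_one _).symm
        _ ≤ ‖f (z + y)‖ ^ 2 * (Real.exp (Real.pi * (R + 1) ^ 2) *
            Real.exp (-Real.pi * ‖z + y‖ ^ 2)) := by gcongr
        _ = _ := by ring
  have h5 : ∫ y in ball (0 : Cn m) 1, Real.exp (Real.pi * (R + 1) ^ 2) * (‖f (z + y)‖ ^ 2 *
        Real.exp (-Real.pi * ‖z + y‖ ^ 2)) ≤ Real.exp (Real.pi * (R + 1) ^ 2) * ‖f‖ ^ 2 := by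
    rw [integral_const_mul, norm_sq_eq]
    gcongr
    refine (setIntegral_le_integral hint (ae_of_all _ fun y => by positivity)).trans_eq ?_
    exact integral_add_left_eq_self
      (fun y : Cn m => ‖f y‖ ^ 2 * Real.exp (-Real.pi * ‖y‖ ^ 2)) z
  rw [mul_assoc, inv_mul_eq_div, le_div_iff₀ hV, mul_comm]
  exact h1.trans (h2.trans h5)

/-- A locally uniformly Cauchy sequence of entire functions has an entire pointwise limit. -/
theorem differentiable_of_locally_uniform {F : ℕ → Cn m → ℂ} {f : Cn m → ℂ}
    (hF : ∀ n, Differentiable ℂ (F n)) (hlim : ∀ z, Tendsto (fun n => F n z) atTop (𝓝 (f z)))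
    (hC : ∀ R : ℝ, ∀ ε > 0, ∃ N, ∀ k ≥ N, ∀ l ≥ N, ∀ z, ‖z‖ ≤ R → ‖F k z - F l z‖ ≤ ε) :
    Differentiable ℂ f := by
  have hder : ∀ R : ℝ, ∀ ε > 0, ∃ N, ∀ k ≥ N, ∀ l ≥ N, ∀ z, ‖z‖ ≤ R →
      ‖fderiv ℂ (F k) z - fderiv ℂ (F l) z‖ ≤ ε := by
    intro R ε hε
    obtain ⟨N, hN⟩ := hC (R + 1) ε hε
    refine ⟨N, fun k hk l hl z hz => ?_⟩
    refine ContinuousLinearMap.opNorm_le_of_unit_norm (𝕜 := ℂ) hε.le fun v hv => ?_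
    have hd : Differentiable ℂ fun t : ℂ => F k (z + t • v) - F l (z + t • v) := by
      have := hF k
      have := hF l
      fun_prop
    have hline : ∀ n, HasDerivAt (fun t : ℂ => F n (z + t • v)) (fderiv ℂ (F n) z v) 0 := by
      intro n
      have h1 : HasDerivAt (fun t : ℂ => z + t • v) v 0 := by
        simpa using ((hasDerivAt_id (0 : ℂ)).smul_const v).const_add z
      have h2 : HasFDerivAt (F n) (fderiv ℂ (F n) z) (z + (0 : ℂ) • v) := by
        simpa using (hF n z).hasFDerivAt
      exact h2.comp_hasDerivAt (0 : ℂ) h1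
    have h := Complex.norm_deriv_le_of_forall_mem_sphere_norm_le (C := ε) (c := 0) one_pos
      hd.diffContOnCl (fun t ht => hN k hk l hl _ (by
        have ht1 : ‖t‖ = 1 := by simpa using ht
        calc ‖z + t • v‖ ≤ ‖z‖ + ‖t • v‖ := norm_add_le _ _
          _ ≤ R + 1 := by rw [norm_smul, hv, ht1]; linarith))
    rw [HasDerivAt.deriv ((hline k).fun_sub (hline l)), div_one] at h
    simpa using h
  have hcs : ∀ z, CauchySeq fun n => fderiv ℂ (F n) z := by
    intro z
    rw [Metric.cauchySeq_iff]
    intro ε hε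
    obtain ⟨N, hN⟩ := hder ‖z‖ (ε / 2) (by positivity)
    refine ⟨N, fun k hk l hl => ?_⟩
    rw [dist_eq_norm]
    exact (hN k hk l hl z le_rfl).trans_lt (by linarith)
  choose G hG using fun z => cauchySeq_tendsto_of_complete (hcs z)
  intro z
  have hunif : TendstoLocallyUniformlyOn (fun n => fderiv ℂ (F n)) G atTop Set.univ := by
    rw [Metric.tendstoLocallyUniformlyOn_iff]
    intro ε hε x _
    refine ⟨ball x 1, mem_nhdsWithin_of_mem_nhds (ball_mem_nhds _ one_pos), ?_⟩
    obtain ⟨N, hN⟩ := hder (‖x‖ + 1) (ε / 2) (by positivity)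
    filter_upwards [eventually_ge_atTop N] with n hn y hy
    have hyn : ‖y‖ ≤ ‖x‖ + 1 := by
      have h1 : ‖y - x‖ < 1 := by rwa [← dist_eq_norm]
      have h2 : ‖y‖ ≤ ‖x‖ + ‖y - x‖ := norm_le_norm_add_norm_sub' y x
      linarith
    have hle : ‖G y - fderiv ℂ (F n) y‖ ≤ ε / 2 := by
      refine le_of_tendsto ((hG y).sub_const _).norm ?_
      filter_upwards [eventually_ge_atTop N] with k hk
      exact hN k hk n hn y hyn
    rw [dist_eq_norm]
    linarith
  exact (hasFDerivAt_of_tendstoLocallyUniformlyOn isOpen_univ hunif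
    (fun n x _ => (hF n x).hasFDerivAt) (fun x _ => hlim x) (Set.mem_univ z)).differentiableAt

/-- The Bargmann–Fock space is complete. -/
instance : CompleteSpace (BargmannFock m) := by
  refine Metric.complete_of_cauchySeq_tendsto fun u hu => ?_
  have hloc : ∀ R : ℝ, ∀ ε > 0, ∃ N, ∀ k ≥ N, ∀ l ≥ N, ∀ z, ‖z‖ ≤ R →
      ‖u k z - u l z‖ ≤ ε := by
    intro R ε hε
    obtain ⟨C, hC0, hC⟩ := exists_norm_apply_le m R
    obtain ⟨N, hN⟩ := Metric.cauchySeq_iff.1 hu (ε / (C + 1)) (by positivity)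
    refine ⟨N, fun k hk l hl z hz => ?_⟩
    have h1 := hC (u k - u l) z hz
    have h2 := (hN k hk l hl).le
    rw [dist_eq_norm, le_div_iff₀ (by positivity)] at h2
    rw [sub_apply] at h1
    refine abs_le_of_sq_le_sq' (h1.trans ?_) hε.le |>.2
    have h3 : (‖u k - u l‖ * (C + 1)) ^ 2 ≤ ε ^ 2 := by gcongr
    refine le_trans ?_ h3
    rw [mul_pow, mul_comm]
    gcongr
    nlinarith
  have hpt : ∀ z, CauchySeq fun n => u n z := by
    intro z
    rw [Metric.cauchySeq_iff]
    intro ε hε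
    obtain ⟨N, hN⟩ := hloc ‖z‖ (ε / 2) (by positivity)
    refine ⟨N, fun k hk l hl => ?_⟩
    rw [dist_eq_norm]
    exact (hN k hk l hl z le_rfl).trans_lt (by linarith)
  choose f hf using fun z => cauchySeq_tendsto_of_complete (hpt z)
  have hfd : Differentiable ℂ f :=
    differentiable_of_locally_uniform (fun n => (u n).differentiable) hf hloc
  have hfc := hfd.continuous
  have key : ∀ ε > 0, ∃ N, ∀ n ≥ N,
      ∫⁻ z : Cn m, ENNReal.ofReal (‖u n z - f z‖ ^ 2 * Real.exp (-Real.pi * ‖z‖ ^ 2)) ≤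
        ENNReal.ofReal (ε ^ 2) := by
    intro ε hε
    obtain ⟨N, hN⟩ := Metric.cauchySeq_iff.1 hu ε hε
    refine ⟨N, fun n hn => ?_⟩
    have hunc := (u n).continuous
    calc ∫⁻ z : Cn m, ENNReal.ofReal (‖u n z - f z‖ ^ 2 * Real.exp (-Real.pi * ‖z‖ ^ 2))
        = ∫⁻ z : Cn m, liminf (fun k => ENNReal.ofReal
            (‖u n z - u k z‖ ^ 2 * Real.exp (-Real.pi * ‖z‖ ^ 2))) atTop := by
          refine lintegral_congr fun z => (Tendsto.liminf_eq ?_).symm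
          exact ENNReal.tendsto_ofReal
            ((((hf z).const_sub (u n z)).norm.pow 2).mul_const _)
      _ ≤ liminf (fun k => ∫⁻ z : Cn m, ENNReal.ofReal
            (‖u n z - u k z‖ ^ 2 * Real.exp (-Real.pi * ‖z‖ ^ 2))) atTop := by
          refine lintegral_liminf_le fun k => ?_
          have := (u k).continuous
          exact (Continuous.measurable (by fun_prop)).ennreal_ofReal
      _ ≤ ENNReal.ofReal (ε ^ 2) := by
          refine liminf_le_of_frequently_le' (Eventually.frequently ?_)
          filter_upwards [eventually_ge_atTop N] with k hk
          have h1 := norm_sq_eq (u n - u k)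
          simp only [sub_apply] at h1
          have h2 := (u n - u k).integrable_sq
          simp only [sub_apply] at h2
          rw [← ofReal_integral_eq_lintegral_ofReal h2 (ae_of_all _ fun z => by positivity), ← h1]
          have h3 := (hN n hn k hk).le
          rw [dist_eq_norm] at h3
          gcongr
  have hint : ∀ n, ∫⁻ z : Cn m, ENNReal.ofReal
      (‖u n z - f z‖ ^ 2 * Real.exp (-Real.pi * ‖z‖ ^ 2)) < ⊤ →
      (fun z => u n z - f z) ∈ fockSubmodule m := by
    intro n hn
    have hunc := (u n).continuous
    refine ⟨(u n).differentiable.sub hfd, Continuous.aestronglyMeasurable (by fun_prop), ?_⟩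
    rw [hasFiniteIntegral_iff_ofReal (ae_of_all _ fun z => by positivity)]
    exact hn
  obtain ⟨N₁, hN₁⟩ := key 1 one_pos
  have hfmem : f ∈ fockSubmodule m := by
    have h1 := hint N₁ ((hN₁ N₁ le_rfl).trans_lt ENNReal.ofReal_lt_top)
    have h2 := (fockSubmodule m).sub_mem (u N₁).2 h1
    convert h2 using 1
    funext z
    change f z = u N₁ z - (u N₁ z - f z)
    ring
  refine ⟨(⟨f, hfmem⟩ : fockSubmodule m), ?_⟩
  set g : BargmannFock m := (⟨f, hfmem⟩ : fockSubmodule m) with hg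
  rw [Metric.tendsto_atTop]
  intro ε hε
  obtain ⟨N, hN⟩ := key (ε / 2) (by positivity)
  refine ⟨N, fun n hn => ?_⟩
  have h1 := norm_sq_eq (u n - g)
  have h2 := (u n - g).integrable_sq
  have h3 := hN n hn
  have h4 : ∫⁻ z : Cn m, ENNReal.ofReal
      (‖(u n - g) z‖ ^ 2 * Real.exp (-Real.pi * ‖z‖ ^ 2)) ≤ ENNReal.ofReal ((ε / 2) ^ 2) := h3
  rw [← ofReal_integral_eq_lintegral_ofReal h2 (ae_of_all _ fun z => by positivity), ← h1,
    ENNReal.ofReal_le_ofReal_iff (by positivity)] at h4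
  rw [dist_eq_norm]
  have h5 := (abs_le_of_sq_le_sq' h4 (by positivity)).2
  linarith

end BargmannFock

end FockSpace

section HilbertTrace

universe u

variable {H : Type u} [NormedAddCommGroup H] [InnerProductSpace ℂ H] [CompleteSpace H]

/-- `T` is trace class: `∑ ⟪e i, |T| (e i)⟫ < ∞` for orthonormal bases `e`, where
`|T| = (T* T)^{1/2}`. -/
def IsTraceClass (T : H →L[ℂ] H) : Prop :=
  ∀ (ι : Type u) (e : HilbertBasis ι ℂ H),
    Summable fun i => (inner ℂ (e i) (CFC.abs T (e i))).re

/-- `t` is the trace of `T`: `∑ ⟪e i, T (e i)⟫ = t` for every orthonormal basis `e`. -/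
def HasHilbertTrace (T : H →L[ℂ] H) (t : ℂ) : Prop :=
  ∀ (ι : Type u) (e : HilbertBasis ι ℂ H), HasSum (fun i => inner ℂ (e i) (T (e i))) t

end HilbertTrace

section BanachTrace

variable {X : Type*} [NormedAddCommGroup X] [NormedSpace ℂ X]

/-- `T x = ∑ c n * l n x • v n` with `‖l n‖ ≤ 1`, `‖v n‖ ≤ 1` and `∑ |c n| ^ p < ∞`. -/
structure IsNuclearRepr (p : ℝ) (T : X →L[ℂ] X) (c : ℕ → ℂ) (l : ℕ → X →L[ℂ] ℂ)
    (v : ℕ → X) : Prop where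
  norm_functional_le : ∀ n, ‖l n‖ ≤ 1
  norm_vector_le : ∀ n, ‖v n‖ ≤ 1
  summable : Summable fun n => ‖c n‖ ^ p
  hasSum : ∀ x, HasSum (fun n => (c n * l n x) • v n) (T x)

/-- `T` is nuclear of order zero: it has nuclear representations with `p`-summable coefficients
for every `p > 0`. -/
def IsNuclearOfOrderZero (T : X →L[ℂ] X) : Prop :=
  ∀ p : ℝ, 0 < p → ∃ c l v, IsNuclearRepr p T c l v

/-- `T` is nuclear, and its trace `∑ c n * l n (v n)`, computed from any of its nuclear
representations, equals `t`. -/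
def HasNuclearTrace (T : X →L[ℂ] X) (t : ℂ) : Prop :=
  (∃ c l v, IsNuclearRepr 1 T c l v) ∧
    ∀ c l v, IsNuclearRepr 1 T c l v → HasSum (fun n => c n * l n (v n)) t

end BanachTrace

/-- The space `A^∞(U)` of continuous bounded functions on the closure of `U` that are holomorphic on
`U`, with the supremum norm (for bounded `U` the closure is compact, and boundedness is
automatic). -/
def AInfty {m : ℕ} (U : Set (Cn m)) : Submodule ℂ (BoundedContinuousFunction (closure U) ℂ) where
  carrier := {f | ∃ F : Cn m → ℂ, DifferentiableOn ℂ F U ∧ ∀ z : closure U, F z = f z}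
  zero_mem' := ⟨fun _ => 0, differentiableOn_const _, fun _ => rfl⟩
  add_mem' := by
    rintro f g ⟨F, hF, hFf⟩ ⟨G, hG, hGg⟩
    exact ⟨fun z => F z + G z, hF.add hG, fun z => by simp [hFf, hGg]⟩
  smul_mem' := by
    rintro c f ⟨F, hF, hFf⟩
    exact ⟨fun z => c * F z, hF.const_mul c, fun z => by simp [hFf]⟩

/-! ### Circle averaging and Gaussian integrals. -/

section Gaussian

variable {m : ℕ}

/-! Everything is computed on the Fock space; the trace on `A^∞` is then reduced to the Fock trace
by dilations.

On the Fock space, evaluation at `w` is the inner product with `kernel w`, the function `z ↦ exp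
(π⟪w, z⟫)`. Parseval therefore turns `∑ ⟪e i, T (e i)⟫` into the integral of `φ z * exp (π⟪z, A z +
b⟫)` against the Gaussian weight (`hasHilbertTrace_weightedComp`). With the origin moved to the
fixed point `z₀` of `z ↦ A z + b`, the integrand becomes an entire function of `u` with value `φ z₀`
at `0`, times `exp (-π⟪u, (1 - A) u⟫)`, which is invariant under `u ↦ exp (iθ) u`. The mean value
property extracts `φ z₀` (`integral_kernel_diagonal`). The remaining integral is `1 / det (1 - A)`:
in a Schur basis a further circle action deforms the triangular form to its diagonal without
changing the integral (`integral_cexp_inner_one_sub`). Trace class follows by writing `T` as a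
product of two weighted compositions, each Hilbert–Schmidt because the kernel gives a square
integrable majorant (`isTraceClass_weightedComp`).

On `A^∞` of a ball, the operator factors through a dilation by some `ρ < 1`. The Taylor expansion of
the dilation writes it as a sum of rank one operators of norm at most `ρ ^ |α|`, since `(t i) ↦ (t i
* z i)` keeps the unit polydisc inside the ball and Cauchy's estimate then loses no constant
(`norm_taylorCoeff_mul_le`). Geometric coefficients are `p`-summable for every `p > 0`.

For the trace, take any nuclear representation and replace `v n` by its dilation `D v n`. Then `∑ c
n * l n (D v n)` equals the sum over `α` of `ρ ^ |α|` times the `α`-th Taylor coefficient of `S (z ^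
α)`, which no longer involves the representation (`AInfty.tsum_dilation_trace`). As `ρ ^ |α| * (A z
+ b) ^ α = (ρ A z + ρ b) ^ α`, this is the sum of the diagonal entries, in the monomial basis of the
Fock space, of the weighted composition with `ρ A` and `ρ b`, whose trace is known. Letting `ρ → 1`
gives the result. -/

/-- The rotation of the coordinates by the angles `t i`. -/
noncomputable def diagRotation (t : Fin m → ℝ) : Cn m ≃ₗᵢ[ℝ] Cn m :=
  LinearIsometryEquiv.piLpCongrRight 2 fun i => rotation (Circle.exp (t i))

@[simp] theorem diagRotation_apply (t : Fin m → ℝ) (z : Cn m) (i : Fin m) :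
    diagRotation t z i = Complex.exp (t i * Complex.I) * z i := by
  simp [diagRotation, rotation_apply]

theorem diagRotation_const (θ : ℝ) (z : Cn m) :
    diagRotation (fun _ => θ) z = Complex.exp (θ * Complex.I) • z := by
  ext i; simp

theorem integral_comp_isometry (L : Cn m ≃ₗᵢ[ℝ] Cn m) (F : Cn m → ℂ) :
    ∫ z, F (L z) = ∫ z, F z :=
  L.measurePreserving.integral_comp L.toHomeomorph.measurableEmbedding F

theorem integral_comp_unitary (L : Cn m ≃ₗᵢ[ℂ] Cn m) (F : Cn m → ℂ) :
    ∫ z, F (L z) = ∫ z, F z :=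
  integral_comp_isometry
    { toLinearEquiv := L.toLinearEquiv.restrictScalars ℝ, norm_map' := L.norm_map } F

theorem integrable_comp_isometry (L : Cn m ≃ₗᵢ[ℝ] Cn m) {F : Cn m → ℂ} (hF : Integrable F) :
    Integrable fun z => F (L z) :=
  (L.measurePreserving.integrable_comp_emb L.toHomeomorph.measurableEmbedding).2 hF

/-- If the circle acts on an integrand by isometries and the action extends to an entire family,
then the integral may be computed at the centre of the disc. -/
theorem integral_eq_of_circle_action {Φ : ℂ → Cn m → ℂ} (hc : Continuous (Function.uncurry Φ))
    (hd : ∀ z, Differentiable ℂ fun ζ => Φ ζ z) (L : ℝ → Cn m ≃ₗᵢ[ℝ] Cn m)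
    (hL : ∀ (θ : ℝ) z, Φ (Complex.exp (θ * Complex.I)) z = Φ 1 (L θ z))
    (hi : Integrable (Φ 1)) : ∫ z, Φ 1 z = ∫ z, Φ 0 z := by
  have hrot : ∀ θ : ℝ, ∫ z, Φ (Complex.exp (θ * Complex.I)) z = ∫ z, Φ 1 z := fun θ => by
    simp only [hL]; exact integral_comp_isometry (L θ) _
  have hcirc : ∀ z, ∫ θ in (0 : ℝ)..2 * Real.pi, Φ (Complex.exp (θ * Complex.I)) z =
      2 * Real.pi * Φ 0 z := by
    intro z
    have h := DiffContOnCl.circleAverage (f := fun t : ℂ => Φ t z) (c := 0) (R := 1)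
      (hd z).diffContOnCl
    simp only [Real.circleAverage, circleMap, zero_add, Complex.ofReal_one, one_mul] at h
    rw [← h, Complex.real_smul, ← mul_assoc]
    push_cast
    rw [mul_inv_cancel₀ (by exact_mod_cast (by positivity : (2 * Real.pi : ℝ) ≠ 0)), one_mul]
  have hswap : ∫ θ in (0 : ℝ)..2 * Real.pi, ∫ z, Φ (Complex.exp (θ * Complex.I)) z =
      ∫ z, ∫ θ in (0 : ℝ)..2 * Real.pi, Φ (Complex.exp (θ * Complex.I)) z := by
    refine intervalIntegral_integral_swap ?_
    have hc2 : Continuous (Function.uncurry fun (θ : ℝ) (z : Cn m) =>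
        Φ (Complex.exp (θ * Complex.I)) z) :=
      hc.comp (f := fun p : ℝ × Cn m => (Complex.exp (p.1 * Complex.I), p.2)) (by fun_prop)
    rw [integrable_prod_iff hc2.aestronglyMeasurable]
    refine ⟨ae_of_all _ fun θ => ?_, ?_⟩
    · simp only [Function.uncurry, hL]
      exact integrable_comp_isometry (L θ) hi
    -- The rotations preserve volume, so this inner integral does not depend on `θ` and is
    -- integrable over the bounded interval.
    · have : (fun θ : ℝ => ∫ z, ‖Function.uncurry (fun (θ : ℝ) (z : Cn m) =>
          Φ (Complex.exp (θ * Complex.I)) z) (θ, z)‖) = fun _ => ∫ z, ‖Φ 1 z‖ := by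
        funext θ
        simp only [Function.uncurry, hL]
        exact (L θ).measurePreserving.integral_comp (L θ).toHomeomorph.measurableEmbedding
          fun z => ‖Φ 1 z‖
      rw [this]
      rw [Set.uIoc_of_le (by positivity)]
      exact integrable_const _
  simp only [hrot, hcirc] at hswap
  rw [intervalIntegral.integral_const, sub_zero, Complex.real_smul, integral_const_mul] at hswap
  push_cast at hswap
  exact mul_left_cancel₀ (by simp [Real.pi_ne_zero]) hswap

/-- The mean value property for rotation invariant weights. -/
theorem integral_mul_rotation_invariant {g w : Cn m → ℂ} (hg : Differentiable ℂ g)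
    (hw : Continuous w)
    (hinv : ∀ (θ : ℝ) z, w (Complex.exp (θ * Complex.I) • z) = w z)
    (hi : Integrable fun z => g z * w z) :
    ∫ z, g z * w z = g 0 * ∫ z, w z := by
  have hgc := hg.continuous
  have h := integral_eq_of_circle_action (Φ := fun ζ z => g (ζ • z) * w z)
    (by simp only [Function.uncurry_def]; fun_prop) (fun z => by fun_prop)
    (fun θ => diagRotation fun _ => θ)
    (fun θ z => by simp only [diagRotation_const, one_smul, hinv]) (by simpa using hi)
  simpa [integral_const_mul] using h

theorem integrable_rexp_linear_sub_sq (a : ℝ) {d : ℝ} (hd : 0 < d) :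
    Integrable fun z : Cn m => Real.exp (a * ‖z‖ - d * ‖z‖ ^ 2) := by
  have h := (GaussianFourier.integrable_cexp_neg_mul_sq_norm_add (V := Cn m)
    (b := ((d / 2 : ℝ) : ℂ)) (by simpa using hd) 0 0).norm
  -- Completing the square: half of the Gaussian absorbs the linear term, at the price of the
  -- constant `exp (a ^ 2 / (2 * d))`.
  refine (h.const_mul (Real.exp (a ^ 2 / (2 * d)))).mono'
    (Continuous.aestronglyMeasurable (by fun_prop)) (ae_of_all _ fun z => ?_)
  rw [Real.norm_of_nonneg (Real.exp_pos _).le, Complex.norm_exp, ← Real.exp_add, Real.exp_le_exp]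
  have : (-((d / 2 : ℝ) : ℂ) * (‖z‖ : ℂ) ^ 2 + 0 * ((inner ℝ 0 z : ℝ) : ℂ)).re =
      -(d / 2) * ‖z‖ ^ 2 := by
    rw [← Complex.ofReal_pow, ← Complex.ofReal_neg, ← Complex.ofReal_mul, zero_mul,
      add_zero, Complex.ofReal_re]
  rw [this]
  have h2 : a ^ 2 / (2 * d) - a * ‖z‖ + d / 2 * ‖z‖ ^ 2 = (a - d * ‖z‖) ^ 2 / (2 * d) := by
    field_simp; ring
  have h3 : 0 ≤ (a - d * ‖z‖) ^ 2 / (2 * d) := by positivity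
  linarith

theorem integrable_of_norm_le_rexp {F : Cn m → ℂ} (hF : Continuous F) {C a d : ℝ} (hd : 0 < d)
    (h : ∀ z, ‖F z‖ ≤ C * Real.exp (a * ‖z‖ - d * ‖z‖ ^ 2)) : Integrable F :=
  ((integrable_rexp_linear_sub_sq a hd).const_mul C).mono' hF.aestronglyMeasurable (ae_of_all _ h)

/-- Cauchy–Schwarz. When `‖A‖ < 1` this coercivity makes the Gaussian of `1 - A` integrable and
gives its diagonal entries positive real part in every orthonormal basis. -/
theorem re_inner_one_sub_ge (A : Cn m →L[ℂ] Cn m) (u : Cn m) :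
    (1 - ‖A‖) * ‖u‖ ^ 2 ≤ (inner ℂ u ((1 - A) u)).re := by
  have h1 : ‖inner ℂ u (A u)‖ ≤ ‖A‖ * ‖u‖ ^ 2 := by
    refine (norm_inner_le_norm _ _).trans ?_
    have := A.le_opNorm u
    nlinarith [norm_nonneg u]
  have h2 := (Complex.abs_re_le_norm _).trans h1
  have h3 : (inner ℂ u u).re = ‖u‖ ^ 2 := inner_self_eq_norm_sq (𝕜 := ℂ) u
  rw [sub_apply, inner_sub_right, Complex.sub_re, one_apply_eq_self, h3]
  linarith [(abs_le.1 h2).2]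

/-- Schur triangularization. -/
theorem exists_orthonormalBasis_lowerTriangular (n : ℕ) :
    ∀ (E : Type*) [NormedAddCommGroup E] [InnerProductSpace ℂ E] [FiniteDimensional ℂ E]
      (_ : Module.finrank ℂ E = n) (A : E →ₗ[ℂ] E),
      ∃ b : OrthonormalBasis (Fin n) ℂ E, ∀ i j, i < j → inner ℂ (b i) (A (b j)) = 0 := by
  induction n with
  | zero =>
    intro E _ _ _ hE A
    exact ⟨(stdOrthonormalBasis ℂ E).reindex (finCongr hE), fun i => i.elim0⟩
  | succ n ih =>
    intro E _ _ _ hE A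
    have : Nontrivial E := Module.nontrivial_of_finrank_pos (R := ℂ) (by omega)
    -- An eigenvector of the adjoint, not of `A`: its orthogonal complement is `A`-invariant, so
    -- placing it first makes the matrix lower triangular and the induction continues on the
    -- complement.
    obtain ⟨μ, hμ⟩ := Module.End.exists_eigenvalue (LinearMap.adjoint A)
    obtain ⟨v₀, hv₀⟩ := hμ.exists_hasEigenvector
    set v : E := ((‖v₀‖⁻¹ : ℝ) : ℂ) • v₀ with hv
    have hvn : ‖v‖ = 1 := by
      rw [hv, norm_smul, Complex.norm_real, norm_inv, norm_norm,
        inv_mul_cancel₀ (norm_ne_zero_iff.2 hv₀.2)]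
    have hAv : LinearMap.adjoint A v = μ • v := by
      rw [hv, map_smul, hv₀.apply_eq_smul, smul_comm]
    have hv0 : v ≠ 0 := by
      intro h; simp [h] at hvn
    have : Fact (Module.finrank ℂ E = n + 1) := ⟨hE⟩
    have hperp : ∀ x, inner ℂ v x = 0 → inner ℂ v (A x) = 0 := by
      intro x hx
      rw [← LinearMap.adjoint_inner_left, hAv, inner_smul_left, hx, mul_zero]
    have hinv : ∀ x ∈ (ℂ ∙ v)ᗮ, A x ∈ (ℂ ∙ v)ᗮ := fun x hx => by
      rw [Submodule.mem_orthogonal_singleton_iff_inner_right] at hx ⊢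
      exact hperp x hx
    obtain ⟨b, hb⟩ := ih (ℂ ∙ v)ᗮ (Submodule.finrank_orthogonal_span_singleton hv0)
      (A.restrict hinv)
    have hbv : ∀ i, inner ℂ v (b i : E) = 0 := fun i =>
      Submodule.mem_orthogonal_singleton_iff_inner_right.1 (b i).2
    have hon : Orthonormal ℂ (Fin.cons v (fun i => (b i : E)) : Fin (n + 1) → E) := by
      rw [orthonormal_iff_ite]
      have hb' := orthonormal_iff_ite.1 b.orthonormal
      intro i j
      refine Fin.cases ?_ (fun i => ?_) i <;> refine Fin.cases ?_ (fun j => ?_) j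
      · simp [hvn]
      · simp [hbv, (Fin.succ_ne_zero j).symm]
      · simp only [Fin.cons_succ, Fin.cons_zero, Fin.succ_ne_zero, if_false]
        rw [← inner_conj_symm, hbv, map_zero]
      · simpa using hb' i j
    refine ⟨OrthonormalBasis.mk hon ?_, ?_⟩
    · rw [hon.linearIndependent.span_eq_top_of_card_eq_finrank (by simp [hE])]
    · intro i j hij
      simp only [OrthonormalBasis.coe_mk]
      obtain ⟨j, rfl⟩ := Fin.exists_succ_eq.2 (Fin.ne_zero_of_lt hij)
      refine Fin.cases (fun _ => ?_) (fun i hij => ?_) i hij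
      · simpa using hperp _ (hbv j)
      · simpa using hb i j (by simpa using hij)

/-- In real coordinates this is a product of `2 * m` one-dimensional Gaussians. Each `d i` occurs
twice, once for the real and once for the imaginary part, so the two principal square roots multiply
to `(d i)⁻¹`. -/
theorem integral_cexp_diagonal {d : Fin m → ℂ} (hd : ∀ i, 0 < (d i).re) :
    ∫ v : Cn m, Complex.exp (-Real.pi * ∑ i, d i * (‖v i‖ : ℂ) ^ 2) = (∏ i, d i)⁻¹ := by
  let e := Pi.orthonormalBasis (𝕜 := ℝ) (fun _ : Fin m => Complex.orthonormalBasisOneI)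
  have h1 : ∀ x : (_ : Fin m) × Fin 2 → ℝ,
      Complex.exp (-Real.pi * ∑ i, d i * (‖e.repr.symm (WithLp.toLp 2 x) i‖ : ℂ) ^ 2) =
      Complex.exp (-∑ i, (Real.pi * d i.1) * (x i : ℂ) ^ 2 + ∑ i, (0 : ℂ) * x i) := by
    intro x
    congr 1
    simp only [zero_mul, Finset.sum_const_zero, add_zero, Fintype.sum_sigma, Fin.sum_univ_two]
    rw [neg_mul, Finset.mul_sum]
    congr 1
    refine Finset.sum_congr rfl fun i _ => ?_
    have : e.repr.symm (WithLp.toLp 2 x) i = x ⟨i, 0⟩ + x ⟨i, 1⟩ * Complex.I := by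
      simp [e, Pi.orthonormalBasis]
      rfl
    rw [this]
    have : ((‖(x ⟨i, 0⟩ + x ⟨i, 1⟩ * Complex.I : ℂ)‖ : ℝ) : ℂ) ^ 2 =
        (x ⟨i, 0⟩ : ℂ) ^ 2 + (x ⟨i, 1⟩ : ℂ) ^ 2 := by
      rw [← Complex.ofReal_pow, ← Complex.normSq_eq_norm_sq, Complex.normSq_add_mul_I]
      push_cast; ring
    rw [this]; ring
  have h2 := e.repr.symm.measurePreserving.integral_comp
    e.repr.symm.toHomeomorph.measurableEmbedding
    fun v : Cn m => Complex.exp (-Real.pi * ∑ i, d i * (‖v i‖ : ℂ) ^ 2)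
  rw [← h2, ← (PiLp.volume_preserving_toLp _).integral_comp
    (MeasurableEquiv.toLp 2 _).measurableEmbedding]
  simp only [h1]
  rw [GaussianFourier.integral_cexp_neg_sum_mul_add]
  · simp only [Fintype.prod_sigma, Fin.prod_univ_two]
    rw [← Finset.prod_inv_distrib]
    refine Finset.prod_congr rfl fun i _ => ?_
    have hdi : d i ≠ 0 := fun h => by simpa [h] using hd i
    have hpi : (Real.pi : ℂ) ≠ 0 := by exact_mod_cast Real.pi_ne_zero
    have : (Real.pi : ℂ) / (Real.pi * d i) = (d i)⁻¹ := by field_simp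
    simp only [this]
    simp only [ne_eq, OfNat.ofNat_ne_zero, not_false_eq_true, zero_pow, zero_div, Complex.exp_zero,
      mul_one]
    rw [← sq, ← Complex.cpow_nat_mul]
    simp
  · intro i
    have := hd i.1
    simp only [Complex.mul_re, Complex.ofReal_re, Complex.ofReal_im, zero_mul, sub_zero]
    positivity

/-- In a Schur basis only the terms `conj (v i) * v j * B i j` with `j ≤ i` survive. Rotating `v i`
by the angle `-θ * i` multiplies such a term by `exp (iθ) ^ (i - j)`, a nonnegative power, so the
action extends to an entire family in `ζ`; at `ζ = 0` only the diagonal is left, and its product is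
the determinant. -/
theorem integral_cexp_inner_one_sub (A : Cn m →L[ℂ] Cn m) (hA : ‖A‖ < 1) :
    ∫ u : Cn m, Complex.exp (-Real.pi * inner ℂ u ((1 - A) u)) = ((1 - A).det)⁻¹ := by
  obtain ⟨b, hb⟩ := exists_orthonormalBasis_lowerTriangular m (Cn m) (by simp)
    ((1 - A : Cn m →L[ℂ] Cn m) : Cn m →ₗ[ℂ] Cn m)
  set B := LinearMap.toMatrix b.toBasis b.toBasis ((1 - A : Cn m →L[ℂ] Cn m) : Cn m →ₗ[ℂ] Cn m)
    with hB
  have hBij : ∀ i j, B i j = inner ℂ (b i) ((1 - A) (b j)) := fun i j => by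
    rw [hB, LinearMap.toMatrix_apply]
    simp [OrthonormalBasis.repr_apply_apply, orthonormal_iff_ite.1 b.orthonormal]
  have hBt : ∀ i j, i < j → B i j = 0 := fun i j h => by rw [hBij]; exact hb i j h
  have hdet : (1 - A).det = ∏ i, B i i := by
    rw [ContinuousLinearMap.det, ← LinearMap.det_toMatrix b.toBasis]
    exact Matrix.det_of_isLowerTriangular _ fun i j h => hBt i j h
  have hform : ∀ v : Cn m, inner ℂ (b.repr.symm v) ((1 - A) (b.repr.symm v)) =
      ∑ i, ∑ j, starRingEnd ℂ (v i) * v j * B i j := by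
    intro v
    have : b.repr.symm v = ∑ i, v i • b i := (b.sum_repr_symm v).symm
    rw [this, sum_inner]
    refine Finset.sum_congr rfl fun i _ => ?_
    rw [map_sum, inner_sum]
    refine Finset.sum_congr rfl fun j _ => ?_
    rw [map_smul, inner_smul_left, inner_smul_right, hBij]; ring
  rw [hdet, ← integral_comp_unitary b.repr.symm]
  simp only [hform]
  have hre : ∀ i, 0 < (B i i).re := fun i => by
    have := re_inner_one_sub_ge A (b i)
    rw [hBij]
    simp only [b.norm_eq_one] at this
    linarith
  rw [← integral_cexp_diagonal hre]
  -- The natural subtraction truncates to `0` when `i < j`; this is harmless because `B i j = 0`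
  -- there.
  have key := integral_eq_of_circle_action (m := m) (Φ := fun ζ v => Complex.exp
    (-Real.pi * ∑ i, ∑ j, starRingEnd ℂ (v i) * v j * B i j * ζ ^ ((i : ℕ) - (j : ℕ))))
    (by simp only [Function.uncurry_def]; fun_prop) (fun z => by fun_prop)
    (fun θ => diagRotation fun i => -(θ * (i : ℕ))) ?_ ?_
  · simp only [one_pow, mul_one] at key
    rw [key]
    refine integral_congr_ae (ae_of_all _ fun v => ?_)
    simp only
    congr 2
    refine Finset.sum_congr rfl fun i _ => ?_
    rw [Finset.sum_eq_single i]
    · rw [Nat.sub_self, pow_zero, mul_one, Complex.conj_mul', mul_comm]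
    · intro j _ hij
      rcases lt_or_gt_of_ne hij with h | h
      · rw [zero_pow (Nat.sub_ne_zero_of_lt h), mul_zero]
      · rw [hBt i j h, mul_zero, zero_mul]
    · simp
  · intro θ v
    congr 2
    refine Finset.sum_congr rfl fun i _ => Finset.sum_congr rfl fun j _ => ?_
    rcases lt_or_ge i j with h | h
    · simp [hBt i j h]
    · simp only [diagRotation_apply, one_pow, mul_one, map_mul, ← Complex.exp_conj,
        Complex.conj_ofReal, Complex.conj_I, ← Complex.exp_nat_mul]
      have : Complex.exp (((i : ℕ) - (j : ℕ) : ℕ) * (θ * Complex.I)) =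
          Complex.exp (((-(θ * (i : ℕ)) : ℝ) : ℂ) * -Complex.I) *
          Complex.exp (((-(θ * (j : ℕ)) : ℝ) : ℂ) * Complex.I) := by
        rw [← Complex.exp_add, Nat.cast_sub (by exact_mod_cast h)]
        push_cast; ring_nf
      rw [this]; ring
  · simp only [one_pow, mul_one]
    simp only [← hform]
    refine integrable_of_norm_le_rexp (C := 1) (a := 0) (d := Real.pi * (1 - ‖A‖))
      (by fun_prop) (by have := Real.pi_pos; have := sub_pos.2 hA; positivity) fun v => ?_
    rw [Complex.norm_exp, one_mul, zero_mul, zero_sub, Real.exp_le_exp, ← Complex.ofReal_neg,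
      Complex.re_ofReal_mul, neg_mul, mul_assoc]
    have := re_inner_one_sub_ge A (b.repr.symm v)
    rw [LinearIsometryEquiv.norm_map] at this
    exact neg_le_neg (mul_le_mul_of_nonneg_left this Real.pi_pos.le)

theorem apply_inverse_one_sub (A : Cn m →L[ℂ] Cn m) (hA : ‖A‖ < 1) (b : Cn m) :
    A (Ring.inverse (1 - A) b) + b = Ring.inverse (1 - A) b := by
  have h := Ring.mul_inverse_cancel (1 - A) (isUnit_one_sub_of_norm_lt_one hA)
  have h2 := congrArg (fun L : Cn m →L[ℂ] Cn m => L b) h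
  simp only [mul_apply_eq_comp, sub_apply, one_apply_eq_self] at h2
  exact (sub_eq_iff_eq_add'.1 h2).symm

/-- The integral of the kernel of `f ↦ φ · f (A · + b)` over the diagonal. -/
theorem integral_kernel_diagonal (A : Cn m →L[ℂ] Cn m) (hA : ‖A‖ < 1) (b : Cn m) {φ : Cn m → ℂ}
    (hφ : Differentiable ℂ φ)
    (hi : Integrable fun z => φ z * Complex.exp (Real.pi * inner ℂ z (A z + b)) *
      (Real.exp (-Real.pi * ‖z‖ ^ 2) : ℂ)) :
    ∫ z, φ z * Complex.exp (Real.pi * inner ℂ z (A z + b)) *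
      (Real.exp (-Real.pi * ‖z‖ ^ 2) : ℂ) = φ (Ring.inverse (1 - A) b) / (1 - A).det := by
  set z₀ := Ring.inverse (1 - A) b with hz₀
  have hfix : A z₀ + b = z₀ := apply_inverse_one_sub A hA b
  -- At `z = u + z₀` the exponent is `-π⟪u + z₀, (1 - A) u⟫`. The part with `z₀` is holomorphic in
  -- `u` and joins `φ`; the part with `u` is invariant under scalar rotations and serves as the
  -- weight.
  have heq : ∀ u, φ (u + z₀) * Complex.exp (Real.pi * inner ℂ (u + z₀) (A (u + z₀) + b)) *
      (Real.exp (-Real.pi * ‖u + z₀‖ ^ 2) : ℂ) =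
      (φ (u + z₀) * Complex.exp (-Real.pi * innerSL ℂ z₀ ((1 - A) u))) *
        Complex.exp (-Real.pi * inner ℂ u ((1 - A) u)) := by
    intro u
    have h1 : A (u + z₀) + b = A u + z₀ := by rw [map_add, add_assoc, hfix]
    have h2 : ((‖u + z₀‖ ^ 2 : ℝ) : ℂ) = inner ℂ (u + z₀) (u + z₀) := by
      rw [inner_self_eq_norm_sq_to_K]; simp
    rw [h1, mul_assoc, mul_assoc, Complex.ofReal_exp, ← Complex.exp_add, ← Complex.exp_add,
      Complex.ofReal_mul, h2]
    congr 2
    simp only [innerSL_apply_apply, sub_apply, one_apply_eq_self, inner_add_left, inner_add_right,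
      inner_sub_right]
    push_cast
    ring
  rw [← integral_add_right_eq_self _ z₀]
  have hi2 := hi.comp_add_right z₀
  simp only [heq] at hi2 ⊢
  rw [integral_mul_rotation_invariant (by fun_prop) (by fun_prop) ?_ hi2,
    integral_cexp_inner_one_sub A hA]
  · simp [div_eq_mul_inv]
  · intro θ z
    rw [map_smul, inner_smul_left, inner_smul_right, ← mul_assoc, ← mul_assoc, mul_assoc (-_),
      Complex.conj_mul', Complex.norm_exp_ofReal_mul_I, Complex.ofReal_one, one_pow, mul_one]

end Gaussian

/-! ### The reproducing kernel and weighted composition operators on the Fock space. -/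

section FockOperators

variable {m : ℕ}

namespace BargmannFock

/-- An entire function that is square integrable for the Gaussian weight, as an element of the
Bargmann–Fock space. -/
def mk (f : Cn m → ℂ) (hf : Differentiable ℂ f)
    (hi : Integrable fun z : Cn m => ‖f z‖ ^ 2 * Real.exp (-Real.pi * ‖z‖ ^ 2)) : BargmannFock m :=
  (⟨f, hf, hi⟩ : fockSubmodule m)

@[simp] theorem mk_apply (f : Cn m → ℂ) (hf : Differentiable ℂ f)
    (hi : Integrable fun z : Cn m => ‖f z‖ ^ 2 * Real.exp (-Real.pi * ‖z‖ ^ 2)) (z : Cn m) :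
    mk f hf hi z = f z := rfl

theorem integrable_sq_of_norm_le {f : Cn m → ℂ} (hf : Differentiable ℂ f) {C a : ℝ}
    (h : ∀ z, ‖f z‖ ≤ C * Real.exp (a * ‖z‖)) :
    Integrable fun z : Cn m => ‖f z‖ ^ 2 * Real.exp (-Real.pi * ‖z‖ ^ 2) := by
  have hfc := hf.continuous
  refine ((integrable_rexp_linear_sub_sq (2 * a) Real.pi_pos).const_mul (C ^ 2)).mono'
    (Continuous.aestronglyMeasurable (by fun_prop)) (ae_of_all _ fun z => ?_)
  rw [Real.norm_of_nonneg (by positivity)]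
  calc ‖f z‖ ^ 2 * Real.exp (-Real.pi * ‖z‖ ^ 2)
      ≤ (C * Real.exp (a * ‖z‖)) ^ 2 * Real.exp (-Real.pi * ‖z‖ ^ 2) := by gcongr; exact h z
    _ = C ^ 2 * Real.exp (2 * a * ‖z‖ - Real.pi * ‖z‖ ^ 2) := by
      rw [mul_pow, ← Real.exp_nat_mul, mul_assoc, ← Real.exp_add]
      congr 2; push_cast; ring

/-- The reproducing kernel `z ↦ exp(π ⟪w, z⟫)`. -/
noncomputable def kernel (w : Cn m) : BargmannFock m :=
  have hd : Differentiable ℂ fun z : Cn m => Complex.exp (Real.pi * innerSL ℂ w z) := by fun_prop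
  mk _ hd <| integrable_sq_of_norm_le (C := 1) (a := Real.pi * ‖w‖) hd fun z => by
    rw [Complex.norm_exp, one_mul, Real.exp_le_exp, Complex.re_ofReal_mul, mul_assoc]
    exact mul_le_mul_of_nonneg_left ((Complex.re_le_norm _).trans (norm_inner_le_norm (𝕜 := ℂ) w z))
      Real.pi_pos.le

theorem kernel_apply (w z : Cn m) : kernel w z = Complex.exp (Real.pi * inner ℂ w z) := rfl

theorem conj_kernel_apply (w z : Cn m) : starRingEnd ℂ (kernel w z) = kernel z w := by
  rw [kernel_apply, kernel_apply, ← Complex.exp_conj, map_mul, Complex.conj_ofReal, inner_conj_symm]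

/-- The reproducing property is the diagonal integral for the zero matrix and translation `w`, with
`f` in the role of `φ`: the fixed point is `w` and the determinant is `1`. -/
theorem inner_kernel_left (w : Cn m) (f : BargmannFock m) : inner ℂ (kernel w) f = f w := by
  have heq : ∀ z, starRingEnd ℂ (kernel w z) * f z * (Real.exp (-Real.pi * ‖z‖ ^ 2) : ℂ) =
      f z * Complex.exp (Real.pi * inner ℂ z ((0 : Cn m →L[ℂ] Cn m) z + w)) *
      (Real.exp (-Real.pi * ‖z‖ ^ 2) : ℂ) := fun z => by
    rw [conj_kernel_apply, kernel_apply]; simp [mul_comm]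
  have hi := integrable_inner (kernel w) f
  rw [inner_def]
  simp only [heq] at hi ⊢
  rw [integral_kernel_diagonal 0 (by simp) w f.differentiable hi]
  simp [ContinuousLinearMap.det]

theorem norm_kernel_sq (w : Cn m) : ‖kernel w‖ ^ 2 = Real.exp (Real.pi * ‖w‖ ^ 2) := by
  have h : ((‖kernel w‖ ^ 2 : ℝ) : ℂ) = inner ℂ (kernel w) (kernel w) := by
    rw [inner_self_eq_norm_sq_to_K]; simp
  rw [inner_kernel_left, kernel_apply, inner_self_eq_norm_sq_to_K] at h
  rw [← Complex.ofReal_inj, h]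
  push_cast
  rfl

theorem norm_kernel (w : Cn m) : ‖kernel w‖ = Real.exp (Real.pi / 2 * ‖w‖ ^ 2) := by
  rw [← sq_eq_sq₀ (norm_nonneg _) (Real.exp_pos _).le, norm_kernel_sq, ← Real.exp_nat_mul]
  congr 1; push_cast; ring

theorem norm_apply_sq_le (f : BargmannFock m) (w : Cn m) :
    ‖f w‖ ^ 2 ≤ ‖f‖ ^ 2 * Real.exp (Real.pi * ‖w‖ ^ 2) := by
  rw [← inner_kernel_left, ← norm_kernel_sq, ← mul_pow, mul_comm]
  gcongr
  exact norm_inner_le_norm _ _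

/-- Bessel's inequality for `kernel w`. This bound, uniform in the finite set `s`, dominates the
basis sums in the Hilbert–Schmidt and trace estimates. -/
theorem sum_norm_apply_sq_le {ι : Type*} {e : ι → BargmannFock m} (he : Orthonormal ℂ e)
    (s : Finset ι) (w : Cn m) : ∑ i ∈ s, ‖e i w‖ ^ 2 ≤ Real.exp (Real.pi * ‖w‖ ^ 2) := by
  rw [← norm_kernel_sq]
  refine le_trans (le_of_eq ?_) (he.sum_inner_products_le (s := s) (kernel w))
  refine Finset.sum_congr rfl fun i _ => ?_
  rw [← inner_kernel_left, norm_inner_symm]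

theorem eq_zero_of_forall_inner_kernel {f : BargmannFock m}
    (h : ∀ w, inner ℂ f (kernel w) = 0) : f = 0 := by
  refine DFunLike.ext _ _ fun w => ?_
  rw [← inner_kernel_left, ← inner_conj_symm, h, map_zero]
  rfl

/-- By Bessel only countably many basis vectors are nonzero at a given point, and a continuous
function vanishing on a dense sequence is zero. Countability permits exchanging the sum over the
basis with the integral. -/
theorem countable_of_hilbertBasis {ι : Type*} (e : HilbertBasis ι ℂ (BargmannFock m)) :
    Countable ι := by
  have hc : (⋃ n : ℕ, Function.support fun i =>
      ‖e i (TopologicalSpace.denseSeq (Cn m) n)‖ ^ 2).Countable :=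
    Set.countable_iUnion fun n => Summable.countable_support <|
      summable_of_sum_le (fun i => by positivity) fun s => sum_norm_apply_sq_le e.orthonormal s _
  refine Set.countable_univ_iff.1 (hc.mono fun i _ => ?_)
  by_contra hi
  simp only [Set.mem_iUnion, Function.mem_support, not_exists, not_not] at hi
  have h0 : (e i : Cn m → ℂ) = fun _ => 0 :=
    (TopologicalSpace.denseRange_denseSeq (Cn m)).equalizer (e i).continuous continuous_const
      (funext fun n => by simpa using hi n)
  have : e i = 0 := DFunLike.ext _ _ fun z => congrFun h0 z
  exact e.orthonormal.ne_zero i this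

end BargmannFock

open BargmannFock

section Bounds

variable {A : Cn m →L[ℂ] Cn m} {b : Cn m} {φ : Cn m → ℂ} {C a : ℝ}

theorem norm_affine_sq_le (A : Cn m →L[ℂ] Cn m) (b z : Cn m) :
    ‖A z + b‖ ^ 2 ≤ ‖A‖ ^ 2 * ‖z‖ ^ 2 + 2 * ‖A‖ * ‖b‖ * ‖z‖ + ‖b‖ ^ 2 := by
  have h : ‖A z + b‖ ≤ ‖A‖ * ‖z‖ + ‖b‖ :=
    (norm_add_le _ _).trans (add_le_add_left (A.le_opNorm z) _)
  calc ‖A z + b‖ ^ 2 ≤ (‖A‖ * ‖z‖ + ‖b‖) ^ 2 := by gcongr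
    _ = _ := by ring

/-- The integrand is `‖φ z‖ * ‖kernel z‖ * ‖kernel (A z + b)‖` times the Gaussian weight, the
majorant for the trace. It is integrable since the quadratic part of the exponent is at most `-(π /
2) * (1 - ‖A‖ ^ 2) * ‖z‖ ^ 2`. -/
theorem integrable_weighted_kernel (hA : ‖A‖ < 1) (hφ : Continuous φ)
    (hbound : ∀ z, ‖φ z‖ ≤ C * Real.exp (a * ‖z‖)) :
    Integrable fun z : Cn m => ‖φ z‖ * Real.exp (Real.pi / 2 * (‖A z + b‖ ^ 2 - ‖z‖ ^ 2)) := by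
  have hd : 0 < Real.pi / 2 * (1 - ‖A‖ ^ 2) := by
    have : ‖A‖ ^ 2 < 1 := by rw [sq_lt_one_iff₀ (norm_nonneg _)]; exact hA
    have := Real.pi_pos
    have : 0 < 1 - ‖A‖ ^ 2 := by linarith
    positivity
  refine ((integrable_rexp_linear_sub_sq (a + Real.pi * ‖A‖ * ‖b‖) hd).const_mul
    (C * Real.exp (Real.pi / 2 * ‖b‖ ^ 2))).mono'
    (Continuous.aestronglyMeasurable (by fun_prop)) (ae_of_all _ fun z => ?_)
  rw [Real.norm_of_nonneg (by positivity)]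
  have h1 : Real.exp (Real.pi / 2 * (‖A z + b‖ ^ 2 - ‖z‖ ^ 2)) ≤
      Real.exp (Real.pi / 2 * (‖A‖ ^ 2 * ‖z‖ ^ 2 + 2 * ‖A‖ * ‖b‖ * ‖z‖ + ‖b‖ ^ 2 - ‖z‖ ^ 2)) := by
    have := Real.pi_pos
    have := norm_affine_sq_le A b z
    gcongr
  refine (mul_le_mul (hbound z) h1 (Real.exp_pos _).le ((norm_nonneg _).trans (hbound z))).trans_eq
    ?_
  rw [mul_assoc C, mul_assoc C, ← Real.exp_add, ← Real.exp_add]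
  congr 2
  ring

/-- The integral of `‖φ z‖ ^ 2 * ‖kernel (A z + b)‖ ^ 2` against the weight bounds both the squared
operator norm and the squared Hilbert–Schmidt norm of the weighted composition. -/
theorem integrable_weighted_kernel_sq (hA : ‖A‖ < 1) (hφ : Continuous φ)
    (hbound : ∀ z, ‖φ z‖ ≤ C * Real.exp (a * ‖z‖)) :
    Integrable fun z : Cn m => ‖φ z‖ ^ 2 * Real.exp (Real.pi * ‖A z + b‖ ^ 2) *
      Real.exp (-Real.pi * ‖z‖ ^ 2) := by
  have hd : 0 < Real.pi * (1 - ‖A‖ ^ 2) := by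
    have : ‖A‖ ^ 2 < 1 := by rw [sq_lt_one_iff₀ (norm_nonneg _)]; exact hA
    have := Real.pi_pos
    have : 0 < 1 - ‖A‖ ^ 2 := by linarith
    positivity
  refine ((integrable_rexp_linear_sub_sq (2 * a + 2 * Real.pi * ‖A‖ * ‖b‖) hd).const_mul
    (C ^ 2 * Real.exp (Real.pi * ‖b‖ ^ 2))).mono'
    (Continuous.aestronglyMeasurable (by fun_prop)) (ae_of_all _ fun z => ?_)
  rw [Real.norm_of_nonneg (by positivity)]
  calc ‖φ z‖ ^ 2 * Real.exp (Real.pi * ‖A z + b‖ ^ 2) * Real.exp (-Real.pi * ‖z‖ ^ 2)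
      ≤ (C * Real.exp (a * ‖z‖)) ^ 2 *
        Real.exp (Real.pi * (‖A‖ ^ 2 * ‖z‖ ^ 2 + 2 * ‖A‖ * ‖b‖ * ‖z‖ + ‖b‖ ^ 2)) *
        Real.exp (-Real.pi * ‖z‖ ^ 2) := by
        have := Real.pi_pos
        have := norm_affine_sq_le A b z
        gcongr
        exact hbound z
    _ = _ := by
        rw [mul_pow, ← Real.exp_nat_mul]
        simp only [mul_assoc, ← Real.exp_add]
        congr 2
        push_cast; ring

theorem weightedComp_sq_le (f : BargmannFock m) (z : Cn m) :
    ‖φ z * f (A z + b)‖ ^ 2 * Real.exp (-Real.pi * ‖z‖ ^ 2) ≤ ‖f‖ ^ 2 *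
      (‖φ z‖ ^ 2 * Real.exp (Real.pi * ‖A z + b‖ ^ 2) * Real.exp (-Real.pi * ‖z‖ ^ 2)) := by
  rw [norm_mul, mul_pow]
  calc _ ≤ ‖φ z‖ ^ 2 * (‖f‖ ^ 2 * Real.exp (Real.pi * ‖A z + b‖ ^ 2)) *
        Real.exp (-Real.pi * ‖z‖ ^ 2) := by
        gcongr; exact norm_apply_sq_le f _
    _ = _ := by ring

theorem exists_weightedComp (hA : ‖A‖ < 1) (b : Cn m) (hφ : Differentiable ℂ φ)
    (hbound : ∀ z, ‖φ z‖ ≤ C * Real.exp (a * ‖z‖)) :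
    ∃ T : BargmannFock m →L[ℂ] BargmannFock m, ∀ f z, T f z = φ z * f (A z + b) := by
  have hG := integrable_weighted_kernel_sq (b := b) hA hφ.continuous hbound
  have hfd : ∀ f : BargmannFock m, Differentiable ℂ fun z => φ z * f (A z + b) := fun f => by
    have := f.differentiable
    fun_prop
  have hfi : ∀ f : BargmannFock m, Integrable fun z =>
      ‖φ z * f (A z + b)‖ ^ 2 * Real.exp (-Real.pi * ‖z‖ ^ 2) := fun f => by
    have := (hfd f).continuous
    refine (hG.const_mul (‖f‖ ^ 2)).mono' (Continuous.aestronglyMeasurable (by fun_prop))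
      (ae_of_all _ fun z => ?_)
    rw [Real.norm_of_nonneg (by positivity)]
    exact weightedComp_sq_le f z
  let T₀ : BargmannFock m →ₗ[ℂ] BargmannFock m :=
    { toFun := fun f => mk _ (hfd f) (hfi f)
      map_add' := fun f g => DFunLike.ext _ _ fun z => by
        simp only [mk_apply, add_apply]; ring
      map_smul' := fun k f => DFunLike.ext _ _ fun z => by
        simp only [mk_apply, smul_apply, RingHom.id_apply]; ring }
  refine ⟨T₀.mkContinuous (√(∫ z : Cn m, ‖φ z‖ ^ 2 * Real.exp (Real.pi * ‖A z + b‖ ^ 2) *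
      Real.exp (-Real.pi * ‖z‖ ^ 2))) fun f => ?_, fun f z => rfl⟩
  refine abs_le_of_sq_le_sq' ?_ (by positivity) |>.2
  rw [mul_pow, Real.sq_sqrt (integral_nonneg fun z => by positivity), norm_sq_eq, mul_comm,
    ← integral_const_mul]
  exact integral_mono (hfi f) (hG.const_mul _) fun z => weightedComp_sq_le f z

/-- Weighted composition operators are Hilbert–Schmidt. -/
theorem summable_norm_sq_weightedComp (hA : ‖A‖ < 1) (hφ : Continuous φ)
    (hbound : ∀ z, ‖φ z‖ ≤ C * Real.exp (a * ‖z‖)) {T : BargmannFock m →L[ℂ] BargmannFock m}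
    (hT : ∀ f z, T f z = φ z * f (A z + b)) {ι : Type*} {e : ι → BargmannFock m}
    (he : Orthonormal ℂ e) : Summable fun i => ‖T (e i)‖ ^ 2 := by
  have hG := integrable_weighted_kernel_sq (b := b) hA hφ hbound
  refine summable_of_sum_le (c := ∫ z : Cn m, ‖φ z‖ ^ 2 * Real.exp (Real.pi * ‖A z + b‖ ^ 2) *
    Real.exp (-Real.pi * ‖z‖ ^ 2)) (fun i => by positivity) fun s => ?_
  simp only [norm_sq_eq]
  rw [← integral_finsetSum _ fun i _ => (T (e i)).integrable_sq]
  refine integral_mono (integrable_finsetSum _ fun i _ => (T (e i)).integrable_sq) hG fun z => ?_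
  simp only [hT, norm_mul, mul_pow, ← Finset.sum_mul, ← Finset.mul_sum]
  gcongr
  exact sum_norm_apply_sq_le he s _

/-- Pointwise in `z`, the trace series sums to the integral kernel of `T` on the diagonal; dominated
by `integrable_weighted_kernel`, it may be integrated term by term. -/
theorem hasHilbertTrace_weightedComp (hA : ‖A‖ < 1) (hφ : Differentiable ℂ φ)
    (hbound : ∀ z, ‖φ z‖ ≤ C * Real.exp (a * ‖z‖)) {T : BargmannFock m →L[ℂ] BargmannFock m}
    (hT : ∀ f z, T f z = φ z * f (A z + b)) :
    HasHilbertTrace T (φ (Ring.inverse (1 - A) b) / (1 - A).det) := by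
  intro ι e
  have hφc := hφ.continuous
  have := countable_of_hilbertBasis e
  have hG := integrable_weighted_kernel (b := b) hA hφc hbound
  have hint : ∀ i, Integrable fun z => starRingEnd ℂ (e i z) * T (e i) z *
      (Real.exp (-Real.pi * ‖z‖ ^ 2) : ℂ) := fun i => integrable_inner _ _
  have hpt : ∀ z, HasSum (fun i => starRingEnd ℂ (e i z) * T (e i) z *
      (Real.exp (-Real.pi * ‖z‖ ^ 2) : ℂ)) (φ z * Complex.exp (Real.pi * inner ℂ z (A z + b)) *
      (Real.exp (-Real.pi * ‖z‖ ^ 2) : ℂ)) := by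
    intro z
    refine HasSum.mul_right _ ?_
    -- Parseval for two kernels: `∑ e i (A z + b) * conj (e i z)` is the value of `kernel z` at `A z
    -- + b`.
    have h := (e.hasSum_inner_mul_inner (kernel (A z + b)) (kernel z)).mul_left (φ z)
    rw [inner_kernel_left, kernel_apply] at h
    refine h.congr_fun fun i => ?_
    rw [inner_kernel_left, ← inner_conj_symm, inner_kernel_left, hT]
    ring
  have hsum := hasSum_integral_of_summable_integral_norm hint <|
      summable_of_sum_le (c := ∫ z : Cn m, ‖φ z‖ *
        Real.exp (Real.pi / 2 * (‖A z + b‖ ^ 2 - ‖z‖ ^ 2)))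
        (fun i => integral_nonneg fun z => norm_nonneg _) fun s => by
    rw [← integral_finsetSum _ fun i _ => (hint i).norm]
    refine integral_mono (integrable_finsetSum _ fun i _ => (hint i).norm) hG fun z => ?_
    simp only [hT, norm_mul, RCLike.norm_conj, Complex.norm_real, ← Finset.sum_mul]
    rw [Real.norm_of_nonneg (Real.exp_pos _).le]
    have h1 : ∑ i ∈ s, ‖e i z‖ * (‖φ z‖ * ‖e i (A z + b)‖) =
        ‖φ z‖ * ∑ i ∈ s, ‖e i z‖ * ‖e i (A z + b)‖ := by
      rw [Finset.mul_sum]; exact Finset.sum_congr rfl fun i _ => by ring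
    have h2 : ∑ i ∈ s, ‖e i z‖ * ‖e i (A z + b)‖ ≤
        Real.exp (Real.pi / 2 * ‖z‖ ^ 2) * Real.exp (Real.pi / 2 * ‖A z + b‖ ^ 2) := by
      -- Cauchy–Schwarz over the basis indices, then Bessel at `z` and at `A z + b`.
      refine (Real.sum_mul_le_sqrt_mul_sqrt _ _ _).trans ?_
      have hs : ∀ w : Cn m, √(∑ i ∈ s, ‖e i w‖ ^ 2) ≤ Real.exp (Real.pi / 2 * ‖w‖ ^ 2) := by
        intro w
        rw [← norm_kernel]
        refine Real.sqrt_le_iff.2 ⟨norm_nonneg _, ?_⟩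
        rw [norm_kernel_sq]
        exact sum_norm_apply_sq_le e.orthonormal s w
      exact mul_le_mul (hs _) (hs _) (Real.sqrt_nonneg _) (Real.exp_pos _).le
    rw [h1]
    calc _ ≤ ‖φ z‖ * (Real.exp (Real.pi / 2 * ‖z‖ ^ 2) * Real.exp (Real.pi / 2 * ‖A z + b‖ ^ 2)) *
          Real.exp (-Real.pi * ‖z‖ ^ 2) := by gcongr
      _ = _ := by
        rw [mul_assoc, ← Real.exp_add, ← Real.exp_add]
        congr 2; ring
  simp only [(hpt _).tsum_eq] at hsum
  rw [integral_kernel_diagonal A hA b hφ ?_] at hsum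
  · exact hsum
  · refine hG.mono' (Continuous.aestronglyMeasurable (by fun_prop)) (ae_of_all _ fun z => ?_)
    rw [norm_mul, norm_mul, mul_assoc, Complex.norm_real, Real.norm_of_nonneg (Real.exp_pos _).le,
      Complex.norm_exp, ← Real.exp_add, Complex.re_ofReal_mul]
    gcongr
    have h1 : (inner ℂ z (A z + b)).re ≤ ‖z‖ * ‖A z + b‖ :=
      (Complex.re_le_norm _).trans (norm_inner_le_norm _ _)
    have := Real.pi_pos
    nlinarith [sq_nonneg (‖z‖ - ‖A z + b‖)]

end Bounds

end FockOperators

/-! ### Hilbert–Schmidt factorizations and trace class operators. -/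

section TraceClass

variable {H : Type*} [NormedAddCommGroup H] [InnerProductSpace ℂ H] [CompleteSpace H]

theorem norm_abs_apply (T : H →L[ℂ] H) (x : H) : ‖CFC.abs T x‖ = ‖T x‖ := by
  have hsa : ContinuousLinearMap.adjoint (CFC.abs T) = CFC.abs T :=
    (IsSelfAdjoint.of_nonneg (CFC.abs_nonneg T)).star_eq
  have h : inner ℂ (CFC.abs T x) (CFC.abs T x) = inner ℂ (T x) (T x) := by
    rw [← ContinuousLinearMap.adjoint_inner_right, hsa, ← mul_apply_eq_comp, CFC.abs_mul_abs,
      mul_apply_eq_comp, ContinuousLinearMap.star_eq_adjoint,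
      ContinuousLinearMap.adjoint_inner_right]
  rw [inner_self_eq_norm_sq_to_K, inner_self_eq_norm_sq_to_K] at h
  have h2 : ‖CFC.abs T x‖ ^ 2 = ‖T x‖ ^ 2 := by exact_mod_cast h
  exact (sq_eq_sq₀ (norm_nonneg _) (norm_nonneg _)).1 h2

/-- `|T|` factors through `T`. -/
theorem exists_comp_eq_abs (T : H →L[ℂ] H) : ∃ W : H →L[ℂ] H, W ∘L T = CFC.abs T := by
  let K := (LinearMap.range (T : H →ₗ[ℂ] H)).topologicalClosure
  let e : H →ₗ[ℂ] K := (T : H →ₗ[ℂ] H).codRestrict K fun x =>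
    Submodule.le_topologicalClosure _ (LinearMap.mem_range_self _ x)
  have hdense : DenseRange e := by
    intro y
    rw [closure_subtype]
    have hy : (y : H) ∈ closure (LinearMap.range (T : H →ₗ[ℂ] H) : Set H) := y.2
    refine closure_mono ?_ hy
    rintro _ ⟨x, rfl⟩
    exact ⟨e x, ⟨x, rfl⟩, rfl⟩
  have hnorm : ∃ C, ∀ x, ‖((CFC.abs T : H →L[ℂ] H) : H →ₗ[ℂ] H) x‖ ≤ C * ‖e x‖ :=
    ⟨1, fun x => by rw [one_mul]; exact (norm_abs_apply T x).le⟩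
  have : CompleteSpace K := Submodule.topologicalClosure.completeSpace _
  -- On the closure of the range, `W` continuously extends `T x ↦ |T| x`, which is well defined
  -- because `‖|T| x‖ = ‖T x‖`; the projection extends it to all of `H`.
  refine ⟨(LinearMap.extendOfNorm ((CFC.abs T : H →L[ℂ] H) : H →ₗ[ℂ] H) e) ∘L
    K.orthogonalProjectionOnto,
    ContinuousLinearMap.ext fun x => ?_⟩
  have h1 : K.orthogonalProjectionOnto (T x) = e x :=
    Submodule.orthogonalProjectionOnto_mem_subspace_eq_self (e x)
  simp only [ContinuousLinearMap.comp_apply, h1]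
  exact LinearMap.extendOfNorm_eq hdense hnorm x

theorem HilbertBasis.hasSum_norm_inner_sq {H : Type*} [NormedAddCommGroup H]
    [InnerProductSpace ℂ H] {ι : Type*} (e : HilbertBasis ι ℂ H) (x : H) :
    HasSum (fun i => ‖inner ℂ (e i) x‖ ^ 2) (‖x‖ ^ 2) := by
  have h := (Complex.hasSum_re (e.hasSum_inner_mul_inner x x))
  rw [inner_self_eq_norm_sq_to_K] at h
  convert h using 1
  · funext i
    rw [← inner_conj_symm x, Complex.conj_mul', ← Complex.ofReal_pow, Complex.ofReal_re]
  · norm_cast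

/-- The adjoint of a Hilbert–Schmidt operator is Hilbert–Schmidt. -/
theorem summable_norm_adjoint_sq {ι : Type*} (e : HilbertBasis ι ℂ H) {T : H →L[ℂ] H}
    (hT : Summable fun i => ‖T (e i)‖ ^ 2) :
    Summable fun i => ‖ContinuousLinearMap.adjoint T (e i)‖ ^ 2 := by
  -- The squared matrix entries sum by rows to the norms of `T (e i)` and by columns to those of the
  -- adjoint.
  have h : Summable fun p : ι × ι => ‖inner ℂ (e p.2) (T (e p.1))‖ ^ 2 := by
    rw [summable_prod_of_nonneg fun p => by positivity]
    exact ⟨fun i => (e.hasSum_norm_inner_sq (T (e i))).summable,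
      by simpa only [(e.hasSum_norm_inner_sq (T (e _))).tsum_eq] using hT⟩
  have h2 := (h.prod_symm).prod
  refine h2.congr fun i => ?_
  rw [← (e.hasSum_norm_inner_sq (ContinuousLinearMap.adjoint T (e i))).tsum_eq]
  refine tsum_congr fun j => ?_
  rw [ContinuousLinearMap.adjoint_inner_right, norm_inner_symm]
  rfl

/-- A product of two Hilbert–Schmidt operators is trace class. -/
theorem isTraceClass_comp.{u} {H : Type u} [NormedAddCommGroup H] [InnerProductSpace ℂ H]
    [CompleteSpace H] {R S : H →L[ℂ] H}
    (hR : ∀ (ι : Type u) (e : HilbertBasis ι ℂ H), Summable fun i => ‖R (e i)‖ ^ 2)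
    (hS : ∀ (ι : Type u) (e : HilbertBasis ι ℂ H), Summable fun i => ‖S (e i)‖ ^ 2) :
    IsTraceClass (R ∘L S) := by
  intro ι e
  obtain ⟨W, hW⟩ := exists_comp_eq_abs (R ∘L S)
  -- With `|R S| = W R S` grouped as `(W R) S`, the diagonal entry is the inner product of `(W R)*
  -- (e i)` with `S (e i)`, and both families are square summable.
  have h1 : Summable fun i => ‖(W ∘L R) (e i)‖ ^ 2 := by
    refine Summable.of_nonneg_of_le (fun i => by positivity) (fun i => ?_)
      ((hR ι e).mul_left (‖W‖ ^ 2))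
    rw [← mul_pow]
    gcongr
    exact W.le_opNorm _
  refine Summable.of_norm_bounded (((summable_norm_adjoint_sq e h1).add (hS ι e)).div_const 2)
    fun i => ?_
  rw [← hW, Real.norm_eq_abs]
  refine (Complex.abs_re_le_norm _).trans ?_
  have h2 : inner ℂ (e i) ((W ∘L R ∘L S) (e i)) =
      inner ℂ (ContinuousLinearMap.adjoint (W ∘L R) (e i)) (S (e i)) := by
    rw [ContinuousLinearMap.adjoint_inner_left]; rfl
  rw [h2]
  refine (norm_inner_le_norm _ _).trans ?_
  nlinarith [sq_nonneg (‖ContinuousLinearMap.adjoint (W ∘L R) (e i)‖ - ‖S (e i)‖)]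

end TraceClass

section FockTraceClass

variable {m : ℕ} {A : Cn m →L[ℂ] Cn m} {b : Cn m} {φ : Cn m → ℂ} {C a : ℝ}

/-- There is room for a dilation: with `‖A‖ < σ < 1`, `T` is `f ↦ f (σ z)` followed by the weighted
composition with `σ⁻¹ A` and `σ⁻¹ b`. Both linear parts still have norm below `1`, so both factors
are Hilbert–Schmidt. -/
theorem isTraceClass_weightedComp (hA : ‖A‖ < 1) (hφ : Differentiable ℂ φ)
    (hbound : ∀ z, ‖φ z‖ ≤ C * Real.exp (a * ‖z‖)) {T : BargmannFock m →L[ℂ] BargmannFock m}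
    (hT : ∀ f z, T f z = φ z * f (A z + b)) : IsTraceClass T := by
  obtain ⟨σ, hσA, hσ1⟩ := exists_between hA
  have hσ0 : 0 < σ := (norm_nonneg A).trans_lt hσA
  have hσc : (σ : ℂ) ≠ 0 := by exact_mod_cast hσ0.ne'
  have hA' : ‖(σ : ℂ)⁻¹ • A‖ < 1 := by
    rw [norm_smul, norm_inv, Complex.norm_real, Real.norm_of_nonneg hσ0.le, inv_mul_lt_one₀ hσ0]
    exact hσA
  have hD : ‖(σ : ℂ) • (1 : Cn m →L[ℂ] Cn m)‖ < 1 := by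
    refine lt_of_le_of_lt ?_ hσ1
    rw [norm_smul, Complex.norm_real, Real.norm_of_nonneg hσ0.le]
    exact mul_le_of_le_one_right hσ0.le ContinuousLinearMap.norm_id_le
  have hone : ∀ z : Cn m, ‖(1 : ℂ)‖ ≤ 1 * Real.exp (0 * ‖z‖) := by simp
  obtain ⟨R, hR⟩ := exists_weightedComp hA' ((σ : ℂ)⁻¹ • b) hφ hbound
  obtain ⟨S, hS⟩ := exists_weightedComp hD 0 (differentiable_const 1) hone
  have hTRS : T = R ∘L S := by
    refine ContinuousLinearMap.ext fun f => DFunLike.ext _ _ fun z => ?_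
    rw [ContinuousLinearMap.comp_apply, hT, hR, hS, one_mul]
    congr 2
    simp only [smul_apply, one_apply_eq_self, add_zero, ← smul_add]
    rw [smul_inv_smul₀ hσc]
  rw [hTRS]
  exact isTraceClass_comp
    (fun ι e => summable_norm_sq_weightedComp hA' hφ.continuous hbound hR e.orthonormal)
    (fun ι e => summable_norm_sq_weightedComp hD continuous_const hone hS e.orthonormal)

end FockTraceClass

/-! ### The monomial orthonormal basis of the Fock space. -/

section Monomials

variable {m : ℕ}

/-- The monomial `z ^ α`. -/
noncomputable def monomialFun (α : Fin m → ℕ) (z : Cn m) : ℂ := ∏ i, z i ^ α i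

theorem differentiable_monomialFun (α : Fin m → ℕ) : Differentiable ℂ (monomialFun α) := by
  unfold monomialFun
  fun_prop

theorem norm_monomialFun_le (α : Fin m → ℕ) (z : Cn m) :
    ‖monomialFun α z‖ ≤ ‖z‖ ^ ∑ i, α i := by
  rw [monomialFun, norm_prod, ← Finset.prod_pow_eq_pow_sum]
  simp only [norm_pow]
  exact Finset.prod_le_prod (fun i _ => by positivity) fun i _ =>
    pow_le_pow_left₀ (norm_nonneg _) (PiLp.norm_apply_le z i) _

theorem monomialFun_smul (α : Fin m → ℕ) (c : ℂ) (z : Cn m) :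
    monomialFun α (c • z) = c ^ (∑ i, α i) * monomialFun α z := by
  simp [monomialFun, mul_pow, Finset.prod_mul_distrib, Finset.prod_pow_eq_pow_sum]

namespace BargmannFock

/-- The monomial `z ^ α` as an element of the Bargmann–Fock space. -/
noncomputable def monomial (α : Fin m → ℕ) : BargmannFock m :=
  mk (monomialFun α) (differentiable_monomialFun α) <|
    integrable_sq_of_norm_le (C := (∑ i, α i).factorial) (a := 1) (differentiable_monomialFun α)
      fun z => (norm_monomialFun_le α z).trans <| by
        have := Real.pow_div_factorial_le_exp ‖z‖ (norm_nonneg z) (∑ i, α i)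
        rw [one_mul ‖z‖]
        rwa [div_le_iff₀' (by positivity)] at this

@[simp] theorem monomial_apply (α : Fin m → ℕ) (z : Cn m) : monomial α z = ∏ i, z i ^ α i := rfl

theorem monomial_ne_zero (α : Fin m → ℕ) : monomial α ≠ 0 := fun h => by
  have h1 : monomial α (WithLp.toLp 2 fun _ => 1) = 0 := by rw [h]; rfl
  simp at h1

/-- Rotating a coordinate `i` with `α i ≠ β i` by the angle `π / (β i - α i)` changes the sign of
the integrand but not the integral. -/
theorem inner_monomial_of_ne {α β : Fin m → ℕ} (h : α ≠ β) :
    inner ℂ (monomial α) (monomial β) = 0 := by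
  obtain ⟨i, hi⟩ := Function.ne_iff.1 h
  have hne : (β i : ℝ) - α i ≠ 0 := sub_ne_zero.2 (by exact_mod_cast hi.symm)
  have hmon : ∀ (θ : ℝ) (γ : Fin m → ℕ) (z : Cn m), monomial γ (diagRotation (Pi.single i θ) z) =
      Complex.exp ((θ * γ i : ℝ) * Complex.I) * monomial γ z := by
    intro θ γ z
    simp only [monomial_apply, diagRotation_apply, mul_pow, Finset.prod_mul_distrib]
    congr 1
    rw [Finset.prod_eq_single i]
    · rw [Pi.single_eq_same, ← Complex.exp_nat_mul]; push_cast; ring_nf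
    · intro j _ hj; simp [hj]
    · simp
  have key := integral_comp_isometry (diagRotation (Pi.single i (Real.pi / (β i - α i))))
    fun z => starRingEnd ℂ (monomial α z) * monomial β z * (Real.exp (-Real.pi * ‖z‖ ^ 2) : ℂ)
  have hphase : starRingEnd ℂ (Complex.exp ((Real.pi / (β i - α i) * α i : ℝ) * Complex.I)) *
      Complex.exp ((Real.pi / (β i - α i) * β i : ℝ) * Complex.I) = -1 := by
    rw [← Complex.exp_conj, ← Complex.exp_add, map_mul, Complex.conj_ofReal, Complex.conj_I,
      ← Complex.exp_pi_mul_I]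
    congr 1
    have : (Real.pi / (β i - α i) * β i : ℝ) - (Real.pi / (β i - α i) * α i : ℝ) = Real.pi := by
      field_simp
    have h2 := congrArg (fun x : ℝ => (x : ℂ)) this
    rw [Complex.ofReal_sub] at h2
    linear_combination Complex.I * h2
  have heq : ∀ z : Cn m, starRingEnd ℂ (monomial α (diagRotation (Pi.single i
        (Real.pi / (β i - α i))) z)) *
      monomial β (diagRotation (Pi.single i (Real.pi / (β i - α i))) z) *
      (Real.exp (-Real.pi * ‖diagRotation (Pi.single i (Real.pi / (β i - α i))) z‖ ^ 2) : ℂ) =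
      -(starRingEnd ℂ (monomial α z) * monomial β z * (Real.exp (-Real.pi * ‖z‖ ^ 2) : ℂ)) := by
    intro z
    rw [hmon, hmon, map_mul, LinearIsometryEquiv.norm_map]
    linear_combination (starRingEnd ℂ (monomial α z) * monomial β z *
      (Real.exp (-Real.pi * ‖z‖ ^ 2) : ℂ)) * hphase
  simp only [heq, integral_neg] at key
  rw [inner_def]
  exact self_eq_neg.1 key.symm

theorem exists_mem_span_monomial_mul (i : Fin m) {p : BargmannFock m}
    (hp : p ∈ Submodule.span ℂ (Set.range (monomial (m := m)))) :
    ∃ q ∈ Submodule.span ℂ (Set.range (monomial (m := m))), ∀ z, q z = z i * p z := by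
  induction hp using Submodule.span_induction with
  | mem x hx =>
    obtain ⟨α, rfl⟩ := hx
    refine ⟨monomial (α + Pi.single i 1), Submodule.subset_span ⟨_, rfl⟩, fun z => ?_⟩
    simp only [monomial_apply, Pi.add_apply, pow_add, Finset.prod_mul_distrib]
    rw [mul_comm]
    congr 1
    rw [Finset.prod_eq_single i]
    · simp
    · intro j _ hj; simp [hj]
    · simp
  | zero => exact ⟨0, Submodule.zero_mem _, fun z => (mul_zero _).symm⟩
  | add x y _ _ hx hy =>
    obtain ⟨q, hq, hq'⟩ := hx
    obtain ⟨r, hr, hr'⟩ := hy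
    exact ⟨q + r, Submodule.add_mem _ hq hr, fun z => by rw [add_apply, add_apply, hq', hr']; ring⟩
  | smul c x _ hx =>
    obtain ⟨q, hq, hq'⟩ := hx
    exact ⟨c • q, Submodule.smul_mem _ c hq, fun z => by rw [smul_apply, smul_apply, hq']; ring⟩

theorem sum_apply {ι : Type*} (s : Finset ι) (f : ι → BargmannFock m) (z : Cn m) :
    (∑ i ∈ s, f i) z = ∑ i ∈ s, f i z := by
  classical
  induction s using Finset.induction_on with
  | empty => rfl
  | insert i s hi ih => rw [Finset.sum_insert hi, Finset.sum_insert hi, add_apply, ih]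

/-- Up to the factor `π ^ k / k!` these polynomials are the terms of the exponential series of
`kernel w`; they link the span of the monomials to the kernels. -/
theorem exists_mem_span_monomial_pow_inner (w : Cn m) (k : ℕ) :
    ∃ q ∈ Submodule.span ℂ (Set.range (monomial (m := m))), ∀ z, q z = inner ℂ w z ^ k := by
  induction k with
  | zero => exact ⟨monomial 0, Submodule.subset_span ⟨_, rfl⟩, fun z => by simp⟩
  | succ k ih =>
    obtain ⟨p, hp, hp'⟩ := ih
    choose q hq hq' using fun i => exists_mem_span_monomial_mul i hp
    refine ⟨∑ i, starRingEnd ℂ (w i) • q i,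
      Submodule.sum_mem _ fun i _ => Submodule.smul_mem _ _ (hq i), fun z => ?_⟩
    rw [sum_apply, pow_succ, ← hp', PiLp.inner_apply, Finset.mul_sum]
    refine Finset.sum_congr rfl fun i _ => ?_
    rw [smul_apply, hq', RCLike.inner_apply]
    ring

/-- A function orthogonal to all polynomials is orthogonal to each term of the series of `kernel w`,
hence to `kernel w` itself once sum and integral are exchanged; so it vanishes at every `w`. -/
theorem orthogonal_span_monomial :
    (Submodule.span ℂ (Set.range (monomial (m := m))))ᗮ = ⊥ := by
  rw [Submodule.eq_bot_iff]
  intro f hf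
  refine eq_zero_of_forall_inner_kernel fun w => ?_
  choose q hq hq' using exists_mem_span_monomial_pow_inner w
  have hzero : ∀ k, inner ℂ f (((Real.pi ^ k / k.factorial : ℝ) : ℂ) • q k) = 0 := fun k => by
    rw [inner_smul_right, Submodule.inner_left_of_mem_orthogonal (hq k) hf, mul_zero]
  have hint := fun k => integrable_inner f (((Real.pi ^ k / k.factorial : ℝ) : ℂ) • q k)
  have hpt : ∀ z, HasSum (fun k => starRingEnd ℂ (f z) *
      (((Real.pi ^ k / k.factorial : ℝ) : ℂ) • q k) z * (Real.exp (-Real.pi * ‖z‖ ^ 2) : ℂ))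
      (starRingEnd ℂ (f z) * kernel w z * (Real.exp (-Real.pi * ‖z‖ ^ 2) : ℂ)) := by
    intro z
    refine (HasSum.mul_left _ ?_).mul_right _
    rw [kernel_apply, Complex.exp_eq_exp_ℂ]
    refine (NormedSpace.expSeries_div_hasSum_exp (𝔸 := ℂ)
      (Real.pi * inner ℂ w z)).congr_fun fun k => ?_
    rw [smul_apply, hq', mul_pow]
    push_cast
    ring
  -- The absolute series is at most `‖f z‖ * exp (π‖w‖‖z‖)` times the weight; `x * y ≤ x ^ 2 + y ^
  -- 2` bounds this by an integrable function.
  have hbd : Integrable fun z : Cn m => ‖f z‖ ^ 2 * Real.exp (-Real.pi * ‖z‖ ^ 2) +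
      Real.exp (2 * (Real.pi * ‖w‖) * ‖z‖ - Real.pi * ‖z‖ ^ 2) :=
    f.integrable_sq.add (integrable_rexp_linear_sub_sq _ Real.pi_pos)
  have hsum := hasSum_integral_of_summable_integral_norm hint <|
      summable_of_sum_range_le (c := ∫ z : Cn m, ‖f z‖ ^ 2 * Real.exp (-Real.pi * ‖z‖ ^ 2) +
        Real.exp (2 * (Real.pi * ‖w‖) * ‖z‖ - Real.pi * ‖z‖ ^ 2))
        (fun i => integral_nonneg fun z => norm_nonneg _) fun n => by
    rw [← integral_finsetSum _ fun i _ => (hint i).norm]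
    refine integral_mono (integrable_finsetSum _ fun i _ => (hint i).norm) hbd fun z => ?_
    have h1 : ∀ k, ‖starRingEnd ℂ (f z) * (((Real.pi ^ k / k.factorial : ℝ) : ℂ) • q k) z *
        (Real.exp (-Real.pi * ‖z‖ ^ 2) : ℂ)‖ ≤ ‖f z‖ * Real.exp (-Real.pi * ‖z‖ ^ 2) *
          ((Real.pi * ‖w‖ * ‖z‖) ^ k / k.factorial) := fun k => by
      rw [norm_mul, norm_mul, RCLike.norm_conj, Complex.norm_real, smul_apply, norm_mul, hq',
        norm_pow, Real.norm_of_nonneg (Real.exp_pos _).le, Complex.norm_real,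
        Real.norm_of_nonneg (by positivity)]
      calc _ ≤ ‖f z‖ * (Real.pi ^ k / k.factorial * (‖w‖ * ‖z‖) ^ k) *
            Real.exp (-Real.pi * ‖z‖ ^ 2) := by gcongr; exact norm_inner_le_norm _ _
        _ = _ := by rw [mul_assoc Real.pi, mul_pow Real.pi]; ring
    refine (Finset.sum_le_sum fun k _ => h1 k).trans ?_
    rw [← Finset.mul_sum]
    calc _ ≤ ‖f z‖ * Real.exp (-Real.pi * ‖z‖ ^ 2) * Real.exp (Real.pi * ‖w‖ * ‖z‖) := by
          gcongr
          exact Real.sum_le_exp_of_nonneg (by positivity) n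
      _ ≤ _ := by
          have h2 : Real.exp (2 * (Real.pi * ‖w‖) * ‖z‖ - Real.pi * ‖z‖ ^ 2) =
              Real.exp (-Real.pi * ‖z‖ ^ 2) * Real.exp (Real.pi * ‖w‖ * ‖z‖) ^ 2 := by
            rw [← Real.exp_nat_mul, ← Real.exp_add]; congr 1; push_cast; ring
          rw [h2]
          have := Real.exp_pos (-Real.pi * ‖z‖ ^ 2)
          nlinarith [sq_nonneg (‖f z‖ - Real.exp (Real.pi * ‖w‖ * ‖z‖)),
            mul_nonneg this.le (sq_nonneg (‖f z‖ - Real.exp (Real.pi * ‖w‖ * ‖z‖))),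
            mul_nonneg this.le (sq_nonneg ‖f z‖),
            mul_nonneg this.le (sq_nonneg (Real.exp (Real.pi * ‖w‖ * ‖z‖)))]
  simp only [(hpt _).tsum_eq, ← inner_def, hzero] at hsum
  exact hsum.unique hasSum_zero

/-- The normalized monomials form an orthonormal basis of the Bargmann–Fock space. -/
theorem exists_hilbertBasis_monomial (m : ℕ) :
    ∃ e : HilbertBasis (Fin m → ℕ) ℂ (BargmannFock m),
      ∀ α, e α = ((‖monomial α‖⁻¹ : ℝ) : ℂ) • monomial α := by
  let v : (Fin m → ℕ) → BargmannFock m := fun α => ((‖monomial α‖⁻¹ : ℝ) : ℂ) • monomial α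
  have hv : Orthonormal ℂ v := by
    refine ⟨fun α => ?_, fun α β h => ?_⟩
    · rw [norm_smul, Complex.norm_real, norm_inv, norm_norm,
        inv_mul_cancel₀ (norm_ne_zero_iff.2 (monomial_ne_zero α))]
    · change inner ℂ (v α) (v β) = 0
      rw [inner_smul_left, inner_smul_right, inner_monomial_of_ne h]; simp
  have hspan : (Submodule.span ℂ (Set.range v))ᗮ = ⊥ := by
    rw [← le_bot_iff, ← orthogonal_span_monomial]
    refine Submodule.orthogonal_le (Submodule.span_le.2 ?_)
    rintro _ ⟨α, rfl⟩
    have : monomial α = (‖monomial α‖ : ℂ) • v α := by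
      have h0 : (‖monomial α‖ : ℂ) ≠ 0 := by
        exact_mod_cast norm_ne_zero_iff.2 (monomial_ne_zero α)
      simp only [v, smul_smul, Complex.ofReal_inv]
      rw [mul_inv_cancel₀ h0, one_smul]
    rw [this]
    exact Submodule.smul_mem _ _ (Submodule.subset_span ⟨α, rfl⟩)
  exact ⟨HilbertBasis.mkOfOrthogonalEqBot hv hspan, fun α => by simp [v]⟩

end BargmannFock

end Monomials

/-! ### Multi-index geometric series. -/

section MultiIndexSums

/-- The value and the absolute summability are proved together because the induction multiplies two
series, which requires absolute convergence. -/
theorem hasSum_pi_prod (m : ℕ) :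
    ∀ {f : Fin m → ℕ → ℂ} {a : Fin m → ℂ}, (∀ i, HasSum (f i) (a i)) →
      (∀ i, Summable fun n => ‖f i n‖) →
      HasSum (fun α : Fin m → ℕ => ∏ i, f i (α i)) (∏ i, a i) ∧
        Summable fun α : Fin m → ℕ => ‖∏ i, f i (α i)‖ := by
  induction m with
  | zero =>
    intro f a _ _
    simp only [Finset.univ_eq_empty, Finset.prod_empty]
    exact ⟨hasSum_unique _, (hasSum_unique _).summable⟩
  | succ m ih =>
    intro f a hf hn
    obtain ⟨h1, h2⟩ := ih (f := fun i => f i.succ) (a := fun i => a i.succ)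
      (fun i => hf i.succ) (fun i => hn i.succ)
    have h3 : Summable fun p : ℕ × (Fin m → ℕ) => ‖f 0 p.1 * ∏ i, f i.succ (p.2 i)‖ := by
      simp only [norm_mul]
      exact (hn 0).mul_of_nonneg h2 (fun _ => norm_nonneg _) fun _ => norm_nonneg _
    have h4 : ∀ p : ℕ × (Fin m → ℕ), ∏ i, f i (Fin.consEquiv (fun _ => ℕ) p i) =
        f 0 p.1 * ∏ i, f i.succ (p.2 i) := fun p => by
      rw [Fin.prod_univ_succ]; simp [Fin.consEquiv]
    constructor
    · rw [← (Fin.consEquiv fun _ => ℕ).hasSum_iff, Fin.prod_univ_succ]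
      exact ((hf 0).mul h1 h3.of_norm).congr_fun fun p => h4 p
    · rw [← (Fin.consEquiv fun _ => ℕ).summable_iff]
      exact h3.congr fun p => congrArg norm (h4 p).symm

theorem summable_prod_pow (m : ℕ) {ρ : Fin m → ℝ} (h0 : ∀ i, 0 ≤ ρ i) (h1 : ∀ i, ρ i < 1) :
    Summable fun α : Fin m → ℕ => ∏ i, ρ i ^ α i := by
  have hn : ∀ i, ‖(ρ i : ℂ)‖ = ρ i := fun i => by
    rw [Complex.norm_real, Real.norm_of_nonneg (h0 i)]
  have h := (hasSum_pi_prod m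
    (fun i => hasSum_geometric_of_norm_lt_one ((hn i).trans_lt (h1 i))) fun i => by
      simpa only [norm_pow, hn] using summable_geometric_of_lt_one (h0 i) (h1 i)).2
  simpa only [norm_prod, norm_pow, hn] using h

theorem summable_pow_sum (m : ℕ) {ρ : ℝ} (h0 : 0 ≤ ρ) (h1 : ρ < 1) :
    Summable fun α : Fin m → ℕ => ρ ^ ∑ i, α i := by
  simpa only [Finset.prod_pow_eq_pow_sum] using
    summable_prod_pow m (fun _ => h0) fun _ => h1

end MultiIndexSums

/-! ### Cauchy's formula and Taylor coefficients on polydiscs. -/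

section TorusCoefficients

variable {m : ℕ}

theorem hasSum_torusIntegral {ι : Type*} [Countable ι] {F : ι → (Fin m → ℂ) → ℂ}
    {f : (Fin m → ℂ) → ℂ} {B : ι → ℝ} {c : Fin m → ℂ} {R : Fin m → ℝ}
    (hF : ∀ i, TorusIntegrable (F i) c R) (hB : Summable B)
    (hle : ∀ i θ, ‖F i (torusMap c R θ)‖ ≤ B i)
    (hs : ∀ θ, HasSum (fun i => F i (torusMap c R θ)) (f (torusMap c R θ))) :
    HasSum (fun i => torusIntegral (F i) c R) (torusIntegral f c R) := by
  refine hasSum_integral_of_dominated_convergence (fun i _ => (∏ i, |R i|) * B i)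
    (fun i => (hF i).function_integrable.aestronglyMeasurable)
    (fun i => ae_of_all _ fun θ => ?_) (ae_of_all _ fun θ => hB.mul_left _)
    ?_ (ae_of_all _ fun θ => (hs θ).const_smul _)
  · rw [norm_smul]
    refine (mul_le_mul_of_nonneg_left (hle i θ) (norm_nonneg _)).trans_eq ?_
    simp
  · have : IsFiniteMeasure (volume.restrict (Set.Icc (0 : Fin m → ℝ) fun _ => 2 * Real.pi)) :=
      ⟨by rw [Measure.restrict_apply_univ]; exact measure_Icc_lt_top⟩
    exact integrable_const _

theorem torusIntegral_prod (f : Fin m → ℂ → ℂ) (c : Fin m → ℂ) (R : Fin m → ℝ) :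
    torusIntegral (fun u => ∏ i, f i (u i)) c R = ∏ i, circleIntegral (f i) (c i) (R i) := by
  have hset : (Set.Icc (0 : Fin m → ℝ) fun _ => 2 * Real.pi) =
      Set.pi Set.univ fun _ => Set.Icc 0 (2 * Real.pi) := (Set.pi_univ_Icc _ _).symm
  rw [torusIntegral, hset, volume_pi, Measure.restrict_pi_pi]
  simp only [smul_eq_mul, ← Finset.prod_mul_distrib, torusMap]
  rw [integral_fintype_prod_eq_prod (fun i (t : ℝ) => R i * Complex.exp (t * Complex.I) *
    Complex.I * f i (c i + R i * Complex.exp (t * Complex.I)))]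
  refine Finset.prod_congr rfl fun i _ => ?_
  rw [circleIntegral_def_Icc]
  simp [circleMap, deriv_circleMap]

theorem torusIntegrable_of_continuousOn {G : (Fin m → ℂ) → ℂ} {s : ℝ} (hs : 0 ≤ s)
    (hG : ContinuousOn G {u | ∀ i, ‖u i‖ = s}) : TorusIntegrable G 0 fun _ => s := by
  have h : Continuous fun θ : Fin m → ℝ => G (torusMap 0 (fun _ => s) θ) := by
    refine hG.comp_continuous (by unfold torusMap; fun_prop) fun θ i => ?_
    simp [torusMap, Complex.norm_exp_ofReal_mul_I, abs_of_nonneg hs]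
  exact h.continuousOn.integrableOn_compact isCompact_Icc

theorem norm_torusMap_zero {s : ℝ} (hs : 0 ≤ s) (θ : Fin m → ℝ) (i : Fin m) :
    ‖torusMap 0 (fun _ => s) θ i‖ = s := by
  simp [torusMap, Complex.norm_exp_ofReal_mul_I, abs_of_nonneg hs]

/-- Cauchy's integral formula for polydiscs. -/
theorem torusIntegral_cauchy (m : ℕ) {s : ℝ} (hs : 0 < s) :
    ∀ {G : (Fin m → ℂ) → ℂ} {V : Set (Fin m → ℂ)}, IsOpen V → (∀ u, (∀ i, ‖u i‖ ≤ s) → u ∈ V) →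
      DifferentiableOn ℂ G V → ∀ {z : Fin m → ℂ}, (∀ i, ‖z i‖ < s) →
      torusIntegral (fun u => (∏ i, (u i - z i)⁻¹) * G u) 0 (fun _ => s) =
        (2 * Real.pi * Complex.I) ^ m * G z := by
  induction m with
  | zero =>
    intro G V _ _ _ z _
    simp [Subsingleton.elim (0 : Fin 0 → ℂ) z]
  | succ m ih =>
    intro G V hV hVs hG z hz
    have hne : ∀ (w : ℂ) i, ‖w‖ = s → w - z i ≠ 0 := fun w i hw h => by
      rw [sub_eq_zero] at h
      have := hz i
      rw [← h, hw] at this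
      exact lt_irrefl _ this
    have hint : TorusIntegrable (fun u => (∏ i, (u i - z i)⁻¹) * G u) 0 fun _ => s := by
      refine torusIntegrable_of_continuousOn hs.le (ContinuousOn.mul ?_ ?_)
      · refine continuousOn_finsetProd _ fun i _ => ContinuousOn.inv₀ (by fun_prop) fun u hu => ?_
        exact hne _ i (hu i)
      · exact hG.continuousOn.mono fun u hu => hVs u fun i => (hu i).le
    rw [torusIntegral_succ hint]
    have hinner : ∀ x ∈ sphere (0 : ℂ) s, torusIntegral (fun y : Fin m → ℂ =>
        (∏ i, ((Fin.cons x y : Fin (m + 1) → ℂ) i - z i)⁻¹) * G (Fin.cons x y)) 0 (fun _ => s) =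
        (x - z 0)⁻¹ • ((2 * Real.pi * Complex.I) ^ m * G (Fin.cons x fun i => z i.succ)) := by
      intro x hx
      have hx : ‖x‖ = s := by simpa using hx
      simp only [Fin.prod_univ_succ, Fin.cons_zero, Fin.cons_succ, mul_assoc]
      rw [torusIntegral_const_mul, smul_eq_mul]
      congr 1
      have hc : Differentiable ℂ fun y : Fin m → ℂ => (Fin.cons x y : Fin (m + 1) → ℂ) := by
        rw [differentiable_pi]
        refine Fin.cases ?_ fun i => ?_
        · simp
        · simp only [Fin.cons_succ]; fun_prop
      rw [← mul_assoc 2]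
      -- The domain is a general open neighbourhood of the closed polydisc because its slices are
      -- again of this kind.
      refine ih (G := fun y => G (Fin.cons x y))
        (V := (fun y => (Fin.cons x y : Fin (m + 1) → ℂ)) ⁻¹' V)
        (hV.preimage hc.continuous) (fun u hu => hVs _ ?_)
        (hG.comp hc.differentiableOn fun y hy => hy) (fun i => hz i.succ)
      exact Fin.cases (by simpa using hx.le) (fun i => by simpa using hu i)
    have h1 : circleIntegral (fun x => torusIntegral (fun y : Fin m → ℂ =>
        (∏ i, ((Fin.cons x y : Fin (m + 1) → ℂ) i - z i)⁻¹) * G (Fin.cons x y)) 0 (fun _ => s))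
        0 s = circleIntegral (fun x => (x - z 0)⁻¹ • ((2 * Real.pi * Complex.I) ^ m *
          G (Fin.cons x fun i => z i.succ))) 0 s := circleIntegral.integral_congr hs.le hinner
    refine h1.trans ?_
    have hd : DifferentiableOn ℂ (fun x => (2 * Real.pi * Complex.I) ^ m *
        G (Fin.cons x fun i => z i.succ)) (closedBall 0 s) := by
      have hc : Differentiable ℂ fun x : ℂ =>
          (Fin.cons x fun i => z i.succ : Fin (m + 1) → ℂ) := by
        rw [differentiable_pi]
        refine Fin.cases ?_ fun i => ?_
        · simp only [Fin.cons_zero]; fun_prop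
        · simp
      refine (hG.comp hc.differentiableOn fun x hx => hVs _ ?_).const_mul _
      exact Fin.cases (by simpa using hx) (fun i => by simpa using (hz i.succ).le)
    rw [hd.circleIntegral_sub_inv_smul (by simpa using hz 0), smul_eq_mul, pow_succ']
    have : (Fin.cons (z 0) fun i => z i.succ : Fin (m + 1) → ℂ) = z := Fin.cons_self_tail z
    rw [this]
    ring

/-- The Taylor coefficients at the origin, as integrals over the torus of radius `s`. -/
noncomputable def torusCoeff (s : ℝ) (α : Fin m → ℕ) (G : (Fin m → ℂ) → ℂ) : ℂ :=
  ((2 * Real.pi * Complex.I) ^ m)⁻¹ *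
    torusIntegral (fun u => (∏ i, (u i ^ (α i + 1))⁻¹) * G u) 0 fun _ => s

theorem two_pi_I_pow_ne_zero : ((2 * Real.pi * Complex.I) ^ m : ℂ) ≠ 0 :=
  pow_ne_zero _ Complex.two_pi_I_ne_zero

theorem continuousOn_prod_inv_pow {s : ℝ} (hs : 0 < s) (α : Fin m → ℕ) :
    ContinuousOn (fun u : Fin m → ℂ => ∏ i, (u i ^ (α i + 1))⁻¹) {u | ∀ i, ‖u i‖ = s} := by
  refine continuousOn_finsetProd _ fun i _ => ContinuousOn.inv₀ (by fun_prop) fun u hu => ?_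
  refine pow_ne_zero _ (norm_ne_zero_iff.1 ?_)
  rw [hu i]
  exact hs.ne'

theorem norm_prod_inv_pow {s : ℝ} (α : Fin m → ℕ) {u : Fin m → ℂ} (hu : ∀ i, ‖u i‖ = s) :
    ‖∏ i, (u i ^ (α i + 1))⁻¹‖ = (s ^ m)⁻¹ * (s ^ ∑ i, α i)⁻¹ := by
  rw [norm_prod]
  simp only [norm_inv, norm_pow, hu]
  simp only [pow_succ, mul_inv]
  rw [Finset.prod_mul_distrib, Finset.prod_inv_distrib, Finset.prod_pow_eq_pow_sum]
  simp [mul_comm]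

theorem norm_torusCoeff_le {s : ℝ} (hs : 0 < s) (α : Fin m → ℕ) {G : (Fin m → ℂ) → ℂ} {M : ℝ}
    (hM : ∀ u, (∀ i, ‖u i‖ = s) → ‖G u‖ ≤ M) : ‖torusCoeff s α G‖ ≤ M * (s ^ ∑ i, α i)⁻¹ := by
  have h := norm_torusIntegral_le_of_norm_le_const (c := (0 : Fin m → ℂ)) (R := fun _ => s)
    (f := fun u => (∏ i, (u i ^ (α i + 1))⁻¹) * G u)
    (C := (s ^ m)⁻¹ * (s ^ ∑ i, α i)⁻¹ * M) fun θ => by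
      rw [norm_mul, norm_prod_inv_pow α (norm_torusMap_zero hs.le θ)]
      exact mul_le_mul_of_nonneg_left (hM _ (norm_torusMap_zero hs.le θ)) (by positivity)
  rw [torusCoeff, norm_mul, norm_inv, norm_pow]
  have h2 : ‖(2 * Real.pi * Complex.I : ℂ)‖ = 2 * Real.pi := by
    simp [abs_of_pos Real.pi_pos]
  rw [h2]
  refine (mul_le_mul_of_nonneg_left h (by positivity)).trans_eq ?_
  have := Real.pi_pos
  simp only [abs_of_pos hs, Finset.prod_const, Finset.card_univ, Fintype.card_fin]
  field_simp

theorem torusCoeff_add {s : ℝ} (hs : 0 < s) (α : Fin m → ℕ) {G K : (Fin m → ℂ) → ℂ}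
    (hG : ContinuousOn G {u | ∀ i, ‖u i‖ = s}) (hK : ContinuousOn K {u | ∀ i, ‖u i‖ = s}) :
    torusCoeff s α (fun u => G u + K u) = torusCoeff s α G + torusCoeff s α K := by
  rw [torusCoeff, torusCoeff, torusCoeff, ← mul_add, ← torusIntegral_add]
  · simp only [mul_add]
  · exact torusIntegrable_of_continuousOn hs.le ((continuousOn_prod_inv_pow hs α).mul hG)
  · exact torusIntegrable_of_continuousOn hs.le ((continuousOn_prod_inv_pow hs α).mul hK)

theorem torusCoeff_const_mul (s : ℝ) (α : Fin m → ℕ) (k : ℂ) (G : (Fin m → ℂ) → ℂ) :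
    torusCoeff s α (fun u => k * G u) = k * torusCoeff s α G := by
  have : (fun u : Fin m → ℂ => (∏ i, (u i ^ (α i + 1))⁻¹) * (k * G u)) =
      fun u => k * ((∏ i, (u i ^ (α i + 1))⁻¹) * G u) := funext fun u => by ring
  rw [torusCoeff, torusCoeff, this, torusIntegral_const_mul, mul_left_comm]

theorem circleIntegral_inv_pow_mul_pow {s : ℝ} (hs : 0 < s) (k l : ℕ) :
    circleIntegral (fun z => (z ^ (k + 1))⁻¹ * z ^ l) 0 s =
      if k = l then 2 * Real.pi * Complex.I else 0 := by
  have hz : Set.EqOn (fun z : ℂ => (z ^ (k + 1))⁻¹ * z ^ l)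
      (fun z => (z - 0) ^ ((l : ℤ) - (k + 1 : ℕ))) (sphere 0 s) := by
    intro z hz
    have h0 : z ≠ 0 := ne_of_mem_sphere hz hs.ne'
    simp only [sub_zero]
    rw [zpow_sub₀ h0, zpow_natCast, zpow_natCast, div_eq_inv_mul]
  rw [circleIntegral.integral_congr hs.le hz]
  split_ifs with h
  · subst h
    have : ((k : ℤ) - (k + 1 : ℕ)) = -1 := by push_cast; ring
    simp only [this, zpow_neg_one]
    exact circleIntegral.integral_sub_center_inv 0 hs.ne'
  · exact circleIntegral.integral_sub_zpow_of_ne (by push_cast; omega) _ _ _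

/-- Taylor coefficients are determined by the values on a torus. -/
theorem torusCoeff_eq_of_hasSum {s : ℝ} (hs : 0 < s) {G : (Fin m → ℂ) → ℂ} {d : (Fin m → ℕ) → ℂ}
    (hG : ∀ u, (∀ i, ‖u i‖ = s) → HasSum (fun β => d β * ∏ i, u i ^ β i) (G u))
    (α : Fin m → ℕ) : torusCoeff s α G = d α := by
  -- Absolute convergence at the single point `(s, …, s)` dominates the series on the whole torus,
  -- so it can be integrated term by term; only `β = α` contributes.
  have hsum : Summable fun β : Fin m → ℕ => ‖d β‖ * s ^ ∑ i, β i := by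
    have h := (hG (fun _ => s) fun i => by simp [abs_of_pos hs]).summable.norm
    simpa [Finset.prod_pow_eq_pow_sum, abs_of_pos hs] using h
  have h := hasSum_torusIntegral (c := (0 : Fin m → ℂ)) (R := fun _ => s)
    (F := fun β u => (∏ i, (u i ^ (α i + 1))⁻¹) * (d β * ∏ i, u i ^ β i))
    (f := fun u => (∏ i, (u i ^ (α i + 1))⁻¹) * G u)
    (B := fun β => (s ^ m)⁻¹ * (s ^ ∑ i, α i)⁻¹ * (‖d β‖ * s ^ ∑ i, β i))
    (fun β => torusIntegrable_of_continuousOn hs.le <|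
      (continuousOn_prod_inv_pow hs α).mul (by fun_prop)) (hsum.mul_left _)
    (fun β θ => by
      rw [norm_mul, norm_prod_inv_pow α (norm_torusMap_zero hs.le θ), norm_mul, norm_prod]
      simp only [norm_pow, norm_torusMap_zero hs.le θ, Finset.prod_pow_eq_pow_sum]
      exact le_rfl)
    (fun θ => (hG _ (norm_torusMap_zero hs.le θ)).mul_left _)
  have hterm : ∀ β, torusIntegral (fun u => (∏ i, (u i ^ (α i + 1))⁻¹) * (d β * ∏ i, u i ^ β i)) 0
      (fun _ => s) = if β = α then (2 * Real.pi * Complex.I) ^ m * d α else 0 := by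
    intro β
    simp only [mul_left_comm _ (d β), ← Finset.prod_mul_distrib]
    rw [torusIntegral_const_mul, torusIntegral_prod fun i z => (z ^ (α i + 1))⁻¹ * z ^ β i]
    simp only [Pi.zero_apply, circleIntegral_inv_pow_mul_pow hs]
    split_ifs with hβ
    · subst hβ; simp [mul_comm]
    · obtain ⟨i, hi⟩ := Function.ne_iff.1 hβ
      rw [Finset.prod_eq_zero (Finset.mem_univ i) (if_neg hi.symm), mul_zero]
  simp only [hterm] at h
  have h2 := h.unique (hasSum_ite_eq α _)
  rw [torusCoeff, h2, inv_mul_cancel_left₀ two_pi_I_pow_ne_zero]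

theorem hasSum_cauchy_kernel {s : ℝ} {z u : Fin m → ℂ} (hz : ∀ i, ‖z i‖ < s)
    (hu : ∀ i, ‖u i‖ = s) :
    HasSum (fun α : Fin m → ℕ => ∏ i, (u i ^ (α i + 1))⁻¹ * z i ^ α i) (∏ i, (u i - z i)⁻¹) := by
  have hu0 : ∀ i, u i ≠ 0 := fun i =>
    norm_ne_zero_iff.1 (((norm_nonneg _).trans_lt (hz i)).trans_eq (hu i).symm).ne'
  have hzu : ∀ i, ‖z i / u i‖ < 1 := fun i => by
    rw [norm_div, hu i, div_lt_one ((norm_nonneg _).trans_lt (hz i))]; exact hz i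
  have hterm : ∀ i (n : ℕ), (u i ^ (n + 1))⁻¹ * z i ^ n = (u i)⁻¹ * (z i / u i) ^ n :=
    fun i n => by rw [div_pow, pow_succ, mul_inv]; ring
  refine (hasSum_pi_prod m (f := fun i n => (u i ^ (n + 1))⁻¹ * z i ^ n) (fun i => ?_)
    fun i => ?_).1
  · simp only [hterm]
    have := (hasSum_geometric_of_norm_lt_one (hzu i)).mul_left (u i)⁻¹
    rwa [← mul_inv, mul_sub, mul_one, mul_div_cancel₀ _ (hu0 i)] at this
  · simp only [hterm, norm_mul, norm_pow]
    exact (summable_geometric_of_lt_one (norm_nonneg _) (hzu i)).mul_left _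

/-- The Taylor expansion in a polydisc. -/
theorem hasSum_torusCoeff {s : ℝ} (hs : 0 < s) {G : (Fin m → ℂ) → ℂ} {V : Set (Fin m → ℂ)}
    (hV : IsOpen V) (hVs : ∀ u, (∀ i, ‖u i‖ ≤ s) → u ∈ V) (hG : DifferentiableOn ℂ G V)
    {z : Fin m → ℂ} (hz : ∀ i, ‖z i‖ < s) :
    HasSum (fun α => torusCoeff s α G * ∏ i, z i ^ α i) (G z) := by
  have hGc : ContinuousOn G {u | ∀ i, ‖u i‖ = s} :=
    hG.continuousOn.mono fun u hu => hVs u fun i => (hu i).le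
  have hcomp : IsCompact {u : Fin m → ℂ | ∀ i, ‖u i‖ = s} := by
    have : {u : Fin m → ℂ | ∀ i, ‖u i‖ = s} = Set.pi Set.univ fun _ => sphere (0 : ℂ) s := by
      ext u; simp [Set.mem_pi]
    rw [this]
    exact isCompact_univ_pi fun _ => isCompact_sphere _ _
  obtain ⟨M, hM⟩ := hcomp.exists_bound_of_continuousOn hGc
  have hratio : ∀ i, ‖z i‖ / s < 1 := fun i => (div_lt_one hs).2 (hz i)
  have hB : Summable fun α : Fin m → ℕ => (s ^ m)⁻¹ * M * ∏ i, (‖z i‖ / s) ^ α i :=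
    (summable_prod_pow m (fun i => by positivity) hratio).mul_left _
  have hF : ∀ α : Fin m → ℕ, TorusIntegrable
      (fun u => (∏ i, z i ^ α i) * ((∏ i, (u i ^ (α i + 1))⁻¹) * G u)) 0 fun _ => s := fun α =>
    torusIntegrable_of_continuousOn hs.le
      (continuousOn_const.mul ((continuousOn_prod_inv_pow hs α).mul hGc))
  have hle : ∀ (α : Fin m → ℕ) u, (∀ i, ‖u i‖ = s) →
      ‖(∏ i, z i ^ α i) * ((∏ i, (u i ^ (α i + 1))⁻¹) * G u)‖ ≤
        (s ^ m)⁻¹ * M * ∏ i, (‖z i‖ / s) ^ α i := by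
    intro α u hu
    rw [norm_mul, norm_mul, norm_prod_inv_pow α hu, norm_prod]
    simp only [norm_pow, div_pow, Finset.prod_div_distrib, Finset.prod_pow_eq_pow_sum _ _ s]
    calc _ ≤ (∏ i, ‖z i‖ ^ α i) * ((s ^ m)⁻¹ * (s ^ ∑ i, α i)⁻¹ * M) := by
          gcongr
          exact hM _ hu
      _ = _ := by rw [div_eq_mul_inv]; ring
  have hsum : ∀ u, (∀ i, ‖u i‖ = s) →
      HasSum (fun α : Fin m → ℕ => (∏ i, z i ^ α i) * ((∏ i, (u i ^ (α i + 1))⁻¹) * G u))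
        ((∏ i, (u i - z i)⁻¹) * G u) := by
    intro u hu
    refine ((hasSum_cauchy_kernel hz hu).mul_right (G u)).congr_fun fun α => ?_
    rw [Finset.prod_mul_distrib]; ring
  have h := hasSum_torusIntegral (f := fun u => (∏ i, (u i - z i)⁻¹) * G u) hF hB
    (fun α θ => hle α _ (norm_torusMap_zero hs.le θ)) fun θ => hsum _ (norm_torusMap_zero hs.le θ)
  rw [torusIntegral_cauchy m hs hV hVs hG hz] at h
  have h2 := h.mul_left ((2 * Real.pi * Complex.I) ^ m)⁻¹
  rw [inv_mul_cancel_left₀ two_pi_I_pow_ne_zero] at h2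
  refine h2.congr_fun fun α => ?_
  rw [torusIntegral_const_mul, torusCoeff]
  ring

end TorusCoefficients

/-! ### Taylor expansion on the ball. -/

section BallExpansion

variable {m : ℕ} {r : ℝ}

/-- The Taylor coefficients at the origin of a function on the ball of radius `r`. -/
noncomputable def taylorCoeff (r : ℝ) (α : Fin m → ℕ) (F : Cn m → ℂ) : ℂ :=
  torusCoeff (r / (m + 1)) α fun u => F (WithLp.toLp 2 u)

/-- This explains the radius in `taylorCoeff`: `‖u‖ ≤ ∑ ‖u i‖ ≤ m * r / (m + 1)`. The `+ 1` makes
the inequality strict and keeps the radius positive when `m = 0`. -/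
theorem norm_toLp_lt_of_le (hr : 0 < r) {u : Fin m → ℂ} (hu : ∀ i, ‖u i‖ ≤ r / (m + 1)) :
    ‖(WithLp.toLp 2 u : Cn m)‖ < r := by
  have h1 : ‖(WithLp.toLp 2 u : Cn m)‖ ≤ ∑ i, ‖u i‖ := by
    refine abs_le_of_sq_le_sq' ?_ (Finset.sum_nonneg fun i _ => norm_nonneg _) |>.2
    rw [EuclideanSpace.norm_sq_eq]
    exact Finset.sum_sq_le_sq_sum_of_nonneg fun i _ => norm_nonneg _
  have h2 : ∑ i, ‖u i‖ ≤ m * (r / (m + 1)) := by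
    refine (Finset.sum_le_sum fun i _ => hu i).trans_eq ?_
    simp
  have h3 : m * (r / (m + 1)) < r := by
    rw [← mul_div_assoc, div_lt_iff₀ (by positivity)]
    linarith
  linarith

theorem norm_toLp_mul_le {t : Fin m → ℂ} (ht : ∀ i, ‖t i‖ ≤ 1) (z : Cn m) :
    ‖(WithLp.toLp 2 fun i => t i * z i : Cn m)‖ ≤ ‖z‖ := by
  refine abs_le_of_sq_le_sq' ?_ (norm_nonneg _) |>.2
  rw [EuclideanSpace.norm_sq_eq, EuclideanSpace.norm_sq_eq]
  refine Finset.sum_le_sum fun i _ => ?_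
  have : ‖t i * z i‖ ≤ ‖z i‖ := by
    rw [norm_mul]; exact mul_le_of_le_one_left (norm_nonneg _) (ht i)
  exact pow_le_pow_left₀ (norm_nonneg _) this 2

theorem differentiable_toLp_mul (z : Cn m) :
    Differentiable ℂ fun t : Fin m → ℂ => (WithLp.toLp 2 fun i => t i * z i : Cn m) := by
  have h : Differentiable ℂ fun t : Fin m → ℂ => fun i => t i * z i := by fun_prop
  exact (PiLp.continuousLinearEquiv 2 ℂ fun _ : Fin m => ℂ).symm.differentiable.comp h

theorem hasSum_taylorCoeff_polydisc (hr : 0 < r) {F : Cn m → ℂ}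
    (hF : DifferentiableOn ℂ F (ball 0 r)) {u : Fin m → ℂ} (hu : ∀ i, ‖u i‖ < r / (m + 1)) :
    HasSum (fun α => taylorCoeff r α F * ∏ i, u i ^ α i) (F (WithLp.toLp 2 u)) := by
  have hd : Differentiable ℂ fun u : Fin m → ℂ => (WithLp.toLp 2 u : Cn m) :=
    (PiLp.continuousLinearEquiv 2 ℂ fun _ : Fin m => ℂ).symm.differentiable
  refine hasSum_torusCoeff (G := fun u => F (WithLp.toLp 2 u))
    (V := (fun u : Fin m → ℂ => (WithLp.toLp 2 u : Cn m)) ⁻¹' ball 0 r) (by positivity)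
    (isOpen_ball.preimage hd.continuous)
    (fun u hu => by simpa using norm_toLp_lt_of_le hr hu)
    (hF.comp hd.differentiableOn fun u hu => hu) hu

theorem differentiableOn_slice {F : Cn m → ℂ} (hF : DifferentiableOn ℂ F (ball 0 r)) (z : Cn m) :
    DifferentiableOn ℂ (fun t : Fin m → ℂ => F (WithLp.toLp 2 fun i => t i * z i))
      ((fun t : Fin m → ℂ => (WithLp.toLp 2 fun i => t i * z i : Cn m)) ⁻¹' ball 0 r) :=
  hF.comp (differentiable_toLp_mul z).differentiableOn fun _ ht => ht

theorem mem_preimage_slice {z : Cn m} (hz : ‖z‖ < r) (t : Fin m → ℂ) (ht : ∀ i, ‖t i‖ ≤ 1) :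
    t ∈ (fun t : Fin m → ℂ => (WithLp.toLp 2 fun i => t i * z i : Cn m)) ⁻¹' ball 0 r := by
  simpa using (norm_toLp_mul_le ht z).trans_lt hz

theorem hasSum_torusCoeff_slice {F : Cn m → ℂ} (hF : DifferentiableOn ℂ F (ball 0 r)) {z : Cn m}
    (hz : ‖z‖ < r) {t : Fin m → ℂ} (ht : ∀ i, ‖t i‖ < 1) :
    HasSum (fun α => torusCoeff 1 α (fun t => F (WithLp.toLp 2 fun i => t i * z i)) *
      ∏ i, t i ^ α i) (F (WithLp.toLp 2 fun i => t i * z i)) :=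
  hasSum_torusCoeff (G := fun t => F (WithLp.toLp 2 fun i => t i * z i)) one_pos
    (isOpen_ball.preimage (differentiable_toLp_mul z).continuous) (mem_preimage_slice hz)
    (differentiableOn_slice hF z) ht

/-- The slice `t ↦ F (t i * z i)` is holomorphic near the closed unit polydisc for every `z` in the
ball. Its expansion and that of `F` at the origin agree on a small torus, so the coefficients match;
this carries Taylor expansions from a small polydisc to the whole ball. -/
theorem torusCoeff_slice (hr : 0 < r) {F : Cn m → ℂ} (hF : DifferentiableOn ℂ F (ball 0 r))
    {z : Cn m} (hz : ‖z‖ < r) (α : Fin m → ℕ) :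
    torusCoeff 1 α (fun t => F (WithLp.toLp 2 fun i => t i * z i)) =
      taylorCoeff r α F * monomialFun α z := by
  set s := r / (m + 1) with hs
  have hs0 : 0 < s := by positivity
  -- `σ < 1` is for the expansion of the slice, `σ * ‖z‖ < s` for that of `F`; the `+ 1` avoids
  -- dividing by zero at `z = 0`.
  obtain ⟨σ, hσ0, hσ⟩ := exists_between
    (show (0 : ℝ) < min 1 (s / (‖z‖ + 1)) by positivity)
  have hσ1 : σ < 1 := hσ.trans_le (min_le_left _ _)
  have hσz : σ * (‖z‖ + 1) < s := by
    rw [← lt_div_iff₀ (by positivity)]; exact hσ.trans_le (min_le_right _ _)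
  rw [← torusCoeff_eq_of_hasSum hσ0
    (d := fun α => torusCoeff 1 α (fun t => F (WithLp.toLp 2 fun i => t i * z i)))
    (fun u hu => hasSum_torusCoeff_slice hF hz fun i => (hu i).trans_lt hσ1) α]
  refine torusCoeff_eq_of_hasSum hσ0 (d := fun α => taylorCoeff r α F * monomialFun α z)
    (fun u hu => ?_) α
  refine (hasSum_taylorCoeff_polydisc hr hF (u := fun i => u i * z i) fun i => ?_).congr_fun
    fun β => ?_
  · rw [norm_mul, hu i]
    have := PiLp.norm_apply_le z i
    nlinarith
  · simp only [mul_pow, Finset.prod_mul_distrib, monomialFun]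
    ring

/-- Cauchy's estimate for the slice on the unit torus, which stays inside the ball. On the boundary
only the monomial is evaluated, so radial continuity suffices and `F` need not extend. -/
theorem norm_taylorCoeff_mul_le (hr : 0 < r) {F : Cn m → ℂ} (hF : DifferentiableOn ℂ F (ball 0 r))
    {M : ℝ} (hM : ∀ z, ‖z‖ < r → ‖F z‖ ≤ M) {z : Cn m} (hz : ‖z‖ ≤ r) (α : Fin m → ℕ) :
    ‖taylorCoeff r α F * monomialFun α z‖ ≤ M := by
  have hopen : ∀ w : Cn m, ‖w‖ < r → ‖taylorCoeff r α F * monomialFun α w‖ ≤ M := by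
    intro w hw
    rw [← torusCoeff_slice hr hF hw]
    refine (norm_torusCoeff_le one_pos α fun u hu => hM _ ?_).trans_eq (by simp)
    exact (norm_toLp_mul_le (fun i => (hu i).le) w).trans_lt hw
  have hlim : Tendsto (fun t : ℝ => ‖taylorCoeff r α F * monomialFun α ((t : ℂ) • z)‖) (𝓝[<] 1)
      (𝓝 ‖taylorCoeff r α F * monomialFun α (((1 : ℝ) : ℂ) • z)‖) := by
    have := (differentiable_monomialFun α).continuous
    have hc : Continuous fun t : ℝ => ‖taylorCoeff r α F * monomialFun α ((t : ℂ) • z)‖ := by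
      fun_prop
    exact hc.continuousWithinAt
  rw [Complex.ofReal_one, one_smul] at hlim
  refine le_of_tendsto hlim ?_
  filter_upwards [Ioo_mem_nhdsLT (zero_lt_one' ℝ)] with t ht
  refine hopen _ ?_
  rw [norm_smul, Complex.norm_real, Real.norm_of_nonneg ht.1.le]
  nlinarith [ht.1, ht.2, norm_nonneg z]

theorem hasSum_taylorCoeff_dilation (hr : 0 < r) {F : Cn m → ℂ}
    (hF : DifferentiableOn ℂ F (ball 0 r)) {ρ : ℝ} (h0 : 0 < ρ) (h1 : ρ < 1) {z : Cn m}
    (hz : ‖z‖ ≤ r) :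
    HasSum (fun α => (ρ : ℂ) ^ (∑ i, α i) * (taylorCoeff r α F * monomialFun α z))
      (F ((ρ : ℂ) • z)) := by
  -- The dilation is split evenly: one factor `√ρ` moves `z`, possibly a boundary point, into the
  -- open ball, the other places `t` in the open unit polydisc.
  set κ := √ρ with hκ
  have hκ0 : 0 ≤ κ := Real.sqrt_nonneg _
  have hκ1 : κ < 1 := by rw [hκ, Real.sqrt_lt' one_pos]; simpa using h1
  have hκκ : (κ : ℂ) * κ = ρ := by rw [← Complex.ofReal_mul, Real.mul_self_sqrt h0.le]
  have hw : ‖(κ : ℂ) • z‖ < r := by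
    rw [norm_smul, Complex.norm_real, Real.norm_of_nonneg hκ0]
    nlinarith [norm_nonneg z]
  have h := hasSum_torusCoeff_slice hF hw (t := fun _ => κ) fun i => by
    rwa [Complex.norm_real, Real.norm_of_nonneg hκ0]
  have hpt : (WithLp.toLp 2 fun i => (κ : ℂ) * ((κ : ℂ) • z) i : Cn m) = (ρ : ℂ) • z := by
    ext i
    simp [← mul_assoc, hκκ]
  rw [hpt] at h
  refine h.congr_fun fun α => ?_
  rw [torusCoeff_slice hr hF hw, monomialFun_smul, Finset.prod_pow_eq_pow_sum, ← hκκ, mul_pow]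
  ring

theorem taylorCoeff_eq_of_hasSum (hr : 0 < r) {F : Cn m → ℂ} {d : (Fin m → ℕ) → ℂ}
    (h : ∀ z, HasSum (fun α => d α * monomialFun α z) (F z)) (α : Fin m → ℕ) :
    taylorCoeff r α F = d α :=
  torusCoeff_eq_of_hasSum (by positivity) (fun _ _ => h _) α

end BallExpansion

/-! ### Fock matrix entries as Taylor coefficients. -/

section FockTaylor

open BargmannFock

variable {m : ℕ} {r : ℝ}

/-- Expanding `f z = ⟪kernel z, f⟫` in the normalized monomials produces the power series of `f`,
and power series coefficients are unique. -/
theorem taylorCoeff_eq_inner (hr : 0 < r) {e : HilbertBasis (Fin m → ℕ) ℂ (BargmannFock m)}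
    (he : ∀ α, e α = ((‖monomial α‖⁻¹ : ℝ) : ℂ) • monomial α) (f : BargmannFock m)
    (α : Fin m → ℕ) : taylorCoeff r α f = inner ℂ (e α) f * ((‖monomial α‖⁻¹ : ℝ) : ℂ) := by
  refine taylorCoeff_eq_of_hasSum hr
    (d := fun α => inner ℂ (e α) f * ((‖monomial α‖⁻¹ : ℝ) : ℂ)) (fun z => ?_) α
  have h := e.hasSum_inner_mul_inner (kernel z) f
  rw [inner_kernel_left] at h
  refine h.congr_fun fun β => ?_
  rw [inner_kernel_left, he β, smul_apply]
  change _ = _ * monomialFun β z * _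
  ring

/-- The trace formula in terms of Taylor coefficients. -/
theorem hasSum_taylorCoeff_weightedComp (hr : 0 < r) {A : Cn m →L[ℂ] Cn m} (hA : ‖A‖ < 1)
    (b : Cn m) {φ : Cn m → ℂ} (hφ : Differentiable ℂ φ) {C a : ℝ}
    (hbound : ∀ z, ‖φ z‖ ≤ C * Real.exp (a * ‖z‖)) :
    HasSum (fun α => taylorCoeff r α fun z => φ z * monomialFun α (A z + b))
      (φ (Ring.inverse (1 - A) b) / (1 - A).det) := by
  obtain ⟨T, hT⟩ := exists_weightedComp hA b hφ hbound
  obtain ⟨e, he⟩ := exists_hilbertBasis_monomial m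
  refine (hasHilbertTrace_weightedComp hA hφ hbound hT _ e).congr_fun fun α => ?_
  have h1 : (fun z => φ z * monomialFun α (A z + b)) = T (monomial α) := by
    funext z; rw [hT]; rfl
  rw [h1, taylorCoeff_eq_inner hr he]
  conv_rhs => rw [he α, map_smul, inner_smul_right, ← he α]
  ring

end FockTaylor

/-! ### Nuclear representations on `A^∞` of a ball. -/

section NuclearIndex

variable {X : Type*} [NormedAddCommGroup X] [NormedSpace ℂ X]

/-- Nuclear representations may be indexed by any countable type. -/
theorem exists_isNuclearRepr_of_countable {ι : Type*} [Countable ι] {p : ℝ} (hp : 0 < p)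
    {T : X →L[ℂ] X} {c : ι → ℂ} {l : ι → X →L[ℂ] ℂ} {v : ι → X} (hl : ∀ i, ‖l i‖ ≤ 1)
    (hv : ∀ i, ‖v i‖ ≤ 1) (hc : Summable fun i => ‖c i‖ ^ p)
    (hT : ∀ x, HasSum (fun i => (c i * l i x) • v i) (T x)) :
    ∃ c l v, IsNuclearRepr p T c l v := by
  obtain ⟨g, hg⟩ := exists_injective_nat ι
  refine ⟨Function.extend g c 0, Function.extend g l 0, Function.extend g v 0, ⟨fun n => ?_,
    fun n => ?_, ?_, fun x => ?_⟩⟩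
  · by_cases h : ∃ i, g i = n
    · obtain ⟨i, rfl⟩ := h
      rw [hg.extend_apply]; exact hl i
    · rw [Function.extend_apply' _ _ _ h]; simp
  · by_cases h : ∃ i, g i = n
    · obtain ⟨i, rfl⟩ := h
      rw [hg.extend_apply]; exact hv i
    · rw [Function.extend_apply' _ _ _ h]; simp
  · rw [← hg.summable_iff]
    · refine hc.congr fun i => ?_
      simp only [Function.comp, hg.extend_apply]
    · intro n hn
      rw [Function.extend_apply' _ _ _ hn]
      simp [hp.ne']
  · rw [← hg.hasSum_iff]
    · refine (hT x).congr_fun fun i => ?_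
      simp only [Function.comp, hg.extend_apply]
    · intro n hn
      rw [Function.extend_apply' _ _ _ hn]
      simp

end NuclearIndex

namespace AInfty

variable {m : ℕ}

section General

variable {U : Set (Cn m)}

/-- The extension by zero of an element of `A^∞(U)` to the whole space. -/
noncomputable def extend (f : AInfty U) : Cn m → ℂ := Function.extend Subtype.val f.1 0

theorem extend_coe (f : AInfty U) (z : closure U) : extend f z = f.1 z :=
  Subtype.val_injective.extend_apply _ _ _

theorem extend_add (f g : AInfty U) {z : Cn m} (hz : z ∈ closure U) :
    extend (f + g) z = extend f z + extend g z := by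
  rw [extend_coe (f + g) ⟨z, hz⟩, extend_coe f ⟨z, hz⟩, extend_coe g ⟨z, hz⟩]; rfl

theorem extend_smul (k : ℂ) (f : AInfty U) {z : Cn m} (hz : z ∈ closure U) :
    extend (k • f) z = k * extend f z := by
  rw [extend_coe (k • f) ⟨z, hz⟩, extend_coe f ⟨z, hz⟩]; rfl

theorem norm_extend_le (f : AInfty U) {z : Cn m} (hz : z ∈ closure U) : ‖extend f z‖ ≤ ‖f‖ := by
  rw [extend_coe f ⟨z, hz⟩]
  exact f.1.norm_coe_le_norm _

theorem norm_le_of_forall {f : AInfty U} {M : ℝ} (hM : 0 ≤ M)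
    (h : ∀ z : closure U, ‖f.1 z‖ ≤ M) : ‖f‖ ≤ M :=
  (BoundedContinuousFunction.norm_le hM).2 h

theorem differentiableOn_extend (f : AInfty U) : DifferentiableOn ℂ (extend f) U := by
  obtain ⟨F, hF, hFf⟩ := f.2
  refine hF.congr fun z hz => ?_
  rw [extend_coe f ⟨z, subset_closure hz⟩, ← hFf]

theorem continuousOn_extend (f : AInfty U) : ContinuousOn (extend f) (closure U) := by
  rw [continuousOn_iff_continuous_domRestrict]
  exact f.1.continuous.congr fun z => (extend_coe f z).symm

/-- A function that is continuous and bounded on the closure of `U` and holomorphic on `U`, as an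
element of `A^∞(U)`. -/
noncomputable def ofFun (F : Cn m → ℂ) (hF : DifferentiableOn ℂ F U)
    (hc : ContinuousOn F (closure U)) (hb : ∃ C, ∀ z ∈ closure U, ‖F z‖ ≤ C) : AInfty U :=
  ⟨BoundedContinuousFunction.ofNormedAddCommGroup (fun z : closure U => F z)
    (continuousOn_iff_continuous_domRestrict.1 hc) hb.choose fun z => hb.choose_spec z z.2,
    F, hF, fun _ => rfl⟩

theorem exists_weightedComp (hU : Bornology.IsBounded U) {φ : Cn m → ℂ} (hφ : Differentiable ℂ φ)
    {ψ : Cn m → Cn m} (hψ : Differentiable ℂ ψ) (hmap : ∀ z ∈ closure U, ψ z ∈ U) :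
    ∃ S : AInfty U →L[ℂ] AInfty U, ∀ f (z : closure U),
      (S f).1 z = φ z * extend f (ψ z) := by
  obtain ⟨M, hM⟩ := hU.isCompact_closure.exists_bound_of_continuousOn hφ.continuous.continuousOn
  have hbd : ∀ (f : AInfty U), ∀ z ∈ closure U, ‖φ z * extend f (ψ z)‖ ≤ |M| * ‖f‖ :=
    fun f z hz => by
      rw [norm_mul]
      exact mul_le_mul ((hM z hz).trans (le_abs_self M))
        (norm_extend_le f (subset_closure (hmap z hz))) (norm_nonneg _) (abs_nonneg _)
  let S₀ : AInfty U →ₗ[ℂ] AInfty U :=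
    { toFun := fun f => ofFun (fun z => φ z * extend f (ψ z))
        (hφ.differentiableOn.mul ((differentiableOn_extend f).comp hψ.differentiableOn
          fun z hz => hmap z (subset_closure hz)))
        (hφ.continuous.continuousOn.mul ((continuousOn_extend f).comp hψ.continuous.continuousOn
          fun z hz => subset_closure (hmap z hz)))
        ⟨_, hbd f⟩
      map_add' := fun f g => Subtype.ext <| BoundedContinuousFunction.ext fun z => by
        change φ z * extend (f + g) (ψ z) = φ z * extend f (ψ z) + φ z * extend g (ψ z)
        rw [extend_add f g (subset_closure (hmap z z.2)), mul_add]
      map_smul' := fun k f => Subtype.ext <| BoundedContinuousFunction.ext fun z => by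
        change φ z * extend (k • f) (ψ z) = k * (φ z * extend f (ψ z))
        rw [extend_smul k f (subset_closure (hmap z z.2)), mul_left_comm] }
  exact ⟨S₀.mkContinuous |M| fun f => norm_le_of_forall (by positivity) fun z => hbd f z z.2,
    fun f z => rfl⟩

end General

section Ball

variable {r : ℝ}

theorem mem_closure_ball (hr : 0 < r) {z : Cn m} : z ∈ closure (ball (0 : Cn m) r) ↔ ‖z‖ ≤ r := by
  rw [closure_ball _ hr.ne', mem_closedBall_zero_iff]

/-- The Taylor coefficients of an element of `A^∞` of a ball, multiplied by the monomials, are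
bounded by its norm. -/
theorem norm_taylorCoeff_extend_mul_le (hr : 0 < r) (f : AInfty (ball (0 : Cn m) r))
    {z : Cn m} (hz : ‖z‖ ≤ r) (α : Fin m → ℕ) :
    ‖taylorCoeff r α (extend f) * monomialFun α z‖ ≤ ‖f‖ :=
  norm_taylorCoeff_mul_le hr (differentiableOn_extend f)
    (fun _ hz => norm_extend_le f ((mem_closure_ball hr).2 hz.le)) hz α

/-- The monomial `z ^ α` on a ball. -/
noncomputable def monomial (r : ℝ) (α : Fin m → ℕ) : AInfty (ball (0 : Cn m) r) :=
  ofFun (monomialFun α) (differentiable_monomialFun α).differentiableOn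
    (differentiable_monomialFun α).continuous.continuousOn
    (isBounded_ball.isCompact_closure.exists_bound_of_continuousOn
      (differentiable_monomialFun α).continuous.continuousOn)

theorem monomial_apply (r : ℝ) (α : Fin m → ℕ) (z : closure (ball (0 : Cn m) r)) :
    (monomial r α).1 z = monomialFun α z := rfl

theorem norm_monomial_pos (hr : 0 < r) (α : Fin m → ℕ) : 0 < ‖monomial r α‖ := by
  have hw : ‖(WithLp.toLp 2 fun _ => ((r / (m + 1) : ℝ) : ℂ) : Cn m)‖ < r :=
    norm_toLp_lt_of_le hr fun i => by
      rw [Complex.norm_real, Real.norm_of_nonneg (by positivity)]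
  have h := (monomial r α).1.norm_coe_le_norm ⟨_, (mem_closure_ball hr).2 hw.le⟩
  refine lt_of_lt_of_le (norm_pos_iff.2 ?_) h
  rw [monomial_apply]
  refine Finset.prod_ne_zero_iff.2 fun i _ => pow_ne_zero _ ?_
  have : r / (m + 1) ≠ 0 := by positivity
  exact Complex.ofReal_ne_zero.2 this

/-- The pointwise bound holds on the whole closed ball, so it passes to the supremum: each rank one
operator extracting the `α`-th Taylor term has norm at most `1`. -/
theorem norm_taylorCoeff_mul_norm_monomial_le (hr : 0 < r) (f : AInfty (ball (0 : Cn m) r))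
    (α : Fin m → ℕ) : ‖taylorCoeff r α (extend f)‖ * ‖monomial r α‖ ≤ ‖f‖ := by
  rw [← norm_smul]
  exact norm_le_of_forall (norm_nonneg _) fun z =>
    norm_taylorCoeff_extend_mul_le hr f ((mem_closure_ball hr).1 z.2) α

theorem continuousOn_extend_torus (hr : 0 < r) (f : AInfty (ball (0 : Cn m) r)) :
    ContinuousOn (fun u : Fin m → ℂ => extend f (WithLp.toLp 2 u))
      {u | ∀ i, ‖u i‖ = r / (m + 1)} :=
  (continuousOn_extend f).comp (by fun_prop) fun _ hu =>
    (mem_closure_ball hr).2 (norm_toLp_lt_of_le hr fun i => (hu i).le).le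

theorem torusCoeff_congr {s : ℝ} (hs : 0 ≤ s) (α : Fin m → ℕ) {G K : (Fin m → ℂ) → ℂ}
    (h : ∀ u, (∀ i, ‖u i‖ = s) → G u = K u) : torusCoeff s α G = torusCoeff s α K := by
  rw [torusCoeff, torusCoeff, torusIntegral, torusIntegral]
  congr 2
  funext θ
  simp only [h _ (norm_torusMap_zero hs θ)]

theorem taylorCoeff_congr (hr : 0 < r) (α : Fin m → ℕ) {F K : Cn m → ℂ}
    (h : ∀ z, ‖z‖ < r → F z = K z) : taylorCoeff r α F = taylorCoeff r α K :=
  torusCoeff_congr (by positivity) α fun _ hu => h _ (norm_toLp_lt_of_le hr fun i => (hu i).le)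

theorem taylorCoeff_const_mul (r : ℝ) (α : Fin m → ℕ) (k : ℂ) (F : Cn m → ℂ) :
    taylorCoeff r α (fun z => k * F z) = k * taylorCoeff r α F :=
  torusCoeff_const_mul _ α k _

/-- The Taylor coefficient functionals. -/
theorem exists_coeffFunctional (hr : 0 < r) (α : Fin m → ℕ) :
    ∃ L : AInfty (ball (0 : Cn m) r) →L[ℂ] ℂ, (∀ f, L f = taylorCoeff r α (extend f)) ∧
      ‖L‖ ≤ ‖monomial r α‖⁻¹ := by
  have hmem : ∀ u : Fin m → ℂ, (∀ i, ‖u i‖ = r / (m + 1)) →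
      (WithLp.toLp 2 u : Cn m) ∈ closure (ball (0 : Cn m) r) := fun u hu =>
    (mem_closure_ball hr).2 (norm_toLp_lt_of_le hr fun i => (hu i).le).le
  have hs : 0 < r / (m + 1) := by positivity
  let L₀ : AInfty (ball (0 : Cn m) r) →ₗ[ℂ] ℂ :=
    { toFun := fun f => taylorCoeff r α (extend f)
      map_add' := fun f g => by
        rw [taylorCoeff, taylorCoeff, taylorCoeff, ← torusCoeff_add hs α
          (continuousOn_extend_torus hr f) (continuousOn_extend_torus hr g)]
        exact torusCoeff_congr hs.le α fun u hu => extend_add f g (hmem u hu)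
      map_smul' := fun k f => by
        rw [RingHom.id_apply, smul_eq_mul, ← taylorCoeff_const_mul]
        exact torusCoeff_congr hs.le α fun u hu => extend_smul k f (hmem u hu) }
  refine ⟨L₀.mkContinuous ‖monomial r α‖⁻¹ fun f => ?_, fun f => rfl,
    L₀.mkContinuous_norm_le (by positivity) _⟩
  rw [inv_mul_eq_div, le_div_iff₀ (norm_monomial_pos hr α)]
  exact norm_taylorCoeff_mul_norm_monomial_le hr f α

/-- Dilations are norm convergent sums of Taylor terms. -/
theorem hasSum_dilation (hr : 0 < r) {ρ : ℝ} (h0 : 0 < ρ) (h1 : ρ < 1)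
    {D : AInfty (ball (0 : Cn m) r) →L[ℂ] AInfty (ball (0 : Cn m) r)}
    (hD : ∀ f (z : closure (ball (0 : Cn m) r)), (D f).1 z = extend f ((ρ : ℂ) • (z : Cn m)))
    (f : AInfty (ball (0 : Cn m) r)) :
    HasSum (fun α => ((ρ : ℂ) ^ (∑ i, α i) * taylorCoeff r α (extend f)) • monomial r α)
      (D f) := by
  -- Summability is established in the ambient complete space of bounded continuous functions, and
  -- the sum is then identified by evaluating at points.
  have hind : Topology.IsInducing (AInfty (ball (0 : Cn m) r)).subtype :=
    Topology.IsInducing.subtypeVal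
  rw [← hind.hasSum_iff]
  have hs : Summable fun α : Fin m → ℕ =>
      ((((ρ : ℂ) ^ (∑ i, α i) * taylorCoeff r α (extend f)) • monomial r α :
        AInfty (ball (0 : Cn m) r)) :
        BoundedContinuousFunction (closure (ball (0 : Cn m) r)) ℂ) := by
    refine Summable.of_norm_bounded ((summable_pow_sum m h0.le h1).mul_right ‖f‖) fun α => ?_
    rw [← Submodule.coe_norm, norm_smul, norm_mul, norm_pow, Complex.norm_real,
      Real.norm_of_nonneg h0.le, mul_assoc]
    gcongr
    exact norm_taylorCoeff_mul_norm_monomial_le hr f α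
  obtain ⟨g, hg⟩ := hs
  have hgD : g = (D f).1 := by
    refine BoundedContinuousFunction.ext fun z => ?_
    have h2 := hg.mapL (BoundedContinuousFunction.evalCLM ℂ z)
    have h3 := hasSum_taylorCoeff_dilation hr (differentiableOn_extend f) h0 h1
      ((mem_closure_ball hr).1 z.2)
    rw [hD]
    refine (h2.congr_fun fun α => ?_).unique h3
    change _ = (_ * _) * monomialFun α z
    ring
  rw [hgD] at hg
  exact hg

theorem exists_dilation (hr : 0 < r) {ρ : ℝ} (h0 : 0 < ρ) (h1 : ρ < 1) :
    ∃ D : AInfty (ball (0 : Cn m) r) →L[ℂ] AInfty (ball (0 : Cn m) r),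
      ∀ f (z : closure (ball (0 : Cn m) r)), (D f).1 z = extend f ((ρ : ℂ) • (z : Cn m)) := by
  obtain ⟨D, hD⟩ := exists_weightedComp (U := ball (0 : Cn m) r) isBounded_ball
    (differentiable_const (1 : ℂ)) (ψ := fun z => (ρ : ℂ) • z) (by fun_prop) fun z hz => by
      rw [mem_closure_ball hr] at hz
      rw [mem_ball_zero_iff, norm_smul, Complex.norm_real, Real.norm_of_nonneg h0.le]
      nlinarith [norm_nonneg z]
  exact ⟨D, fun f z => by rw [hD, one_mul]⟩

/-- Elements of `A^∞` are uniformly continuous on the compact closed ball, and the dilation moves no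
point by more than `|ρ k - 1| * r`. -/
theorem tendsto_dilation (hr : 0 < r) {ρ : ℕ → ℝ} (h0 : ∀ k, 0 < ρ k) (h1 : ∀ k, ρ k < 1)
    (hρ : Tendsto ρ atTop (𝓝 1))
    {D : ℕ → AInfty (ball (0 : Cn m) r) →L[ℂ] AInfty (ball (0 : Cn m) r)}
    (hD : ∀ k f (z : closure (ball (0 : Cn m) r)),
      (D k f).1 z = extend f ((ρ k : ℂ) • (z : Cn m)))
    (f : AInfty (ball (0 : Cn m) r)) : Tendsto (fun k => D k f) atTop (𝓝 f) := by
  have huc := (isBounded_ball (x := (0 : Cn m)) (r := r)).isCompact_closure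
    |>.uniformContinuousOn_of_continuous (continuousOn_extend f)
  rw [Metric.uniformContinuousOn_iff] at huc
  rw [Metric.tendsto_atTop]
  intro ε hε
  obtain ⟨δ, hδ, hfδ⟩ := huc (ε / 2) (by positivity)
  obtain ⟨N, hN⟩ := Metric.tendsto_atTop.1 hρ (δ / (r + 1)) (by positivity)
  refine ⟨N, fun k hk => ?_⟩
  rw [dist_eq_norm]
  refine (norm_le_of_forall (by positivity) fun z => ?_ : ‖D k f - f‖ ≤ ε / 2).trans_lt
    (by linarith)
  have hz := (mem_closure_ball hr).1 z.2
  have h2 : (D k f - f).1 z = extend f ((ρ k : ℂ) • (z : Cn m)) - extend f z := by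
    rw [← hD, extend_coe]; rfl
  rw [h2, ← dist_eq_norm]
  refine (hfδ _ ((mem_closure_ball hr).2 ?_) _ z.2 ?_).le
  · rw [norm_smul, Complex.norm_real, Real.norm_of_nonneg (h0 k).le]
    nlinarith [h1 k, norm_nonneg (z : Cn m)]
  · have h3 : (ρ k : ℂ) • (z : Cn m) - z = ((ρ k - 1 : ℝ) : ℂ) • (z : Cn m) := by
      push_cast; rw [sub_smul, one_smul]
    rw [dist_eq_norm, h3, norm_smul, Complex.norm_real]
    have h4 := hN k hk
    rw [Real.dist_eq, lt_div_iff₀ (by positivity)] at h4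
    rw [Real.norm_eq_abs]
    nlinarith [abs_nonneg (ρ k - 1), norm_nonneg (z : Cn m)]

/-- Weighted composition operators with a contracting affine symbol are nuclear of order zero. -/
theorem isNuclearOfOrderZero_weightedComp (hr : 0 < r) {A : Cn m →L[ℂ] Cn m} {b : Cn m}
    (hAb : ‖A‖ * r + ‖b‖ < r) {φ : Cn m → ℂ} (hφ : Differentiable ℂ φ)
    {S : AInfty (ball (0 : Cn m) r) →L[ℂ] AInfty (ball (0 : Cn m) r)}
    (hS : ∀ f (z : closure (ball (0 : Cn m) r)), (S f).1 z = φ z * extend f (A z + b)) :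
    IsNuclearOfOrderZero S := by
  intro p hp
  -- Since `‖A‖ * r + ‖b‖ < ρ * r`, the map `z ↦ ρ⁻¹ (A z + b)` still sends the closed ball into the
  -- open one, so `S` factors through the dilation by `ρ`.
  obtain ⟨ρ, hρ, hρ1⟩ := exists_between ((div_lt_one hr).2 hAb)
  have h0 : 0 < ρ := lt_of_le_of_lt (by positivity) hρ
  have hρc : (ρ : ℂ) ≠ 0 := by exact_mod_cast h0.ne'
  rw [div_lt_iff₀ hr] at hρ
  have hmap : ∀ z ∈ closure (ball (0 : Cn m) r), (ρ : ℂ)⁻¹ • (A z + b) ∈ ball (0 : Cn m) r := by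
    intro z hz
    rw [mem_closure_ball hr] at hz
    rw [mem_ball_zero_iff, norm_smul, norm_inv, Complex.norm_real, Real.norm_of_nonneg h0.le,
      inv_mul_lt_iff₀ h0]
    refine lt_of_le_of_lt ((norm_add_le _ _).trans (add_le_add_left ?_ _)) hρ
    exact (A.le_opNorm z).trans (by gcongr)
  obtain ⟨S', hS'⟩ := exists_weightedComp isBounded_ball hφ
    (ψ := fun z => (ρ : ℂ)⁻¹ • (A z + b)) (by fun_prop) hmap
  obtain ⟨D, hD⟩ := exists_dilation (m := m) hr h0 hρ1
  choose L hL hLn using exists_coeffFunctional (m := m) hr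
  have hcomp : ∀ f, S f = S' (D f) := fun f =>
    Subtype.ext <| BoundedContinuousFunction.ext fun z => by
      rw [hS, hS', extend_coe (D f) ⟨_, subset_closure (hmap z z.2)⟩, hD, smul_inv_smul₀ hρc]
  -- `K` and `‖monomial r α‖` normalize the functionals and vectors to norm at most `1`, leaving the
  -- coefficients `ρ ^ |α| * K`; the `+ 1` permits division when `S' = 0`.
  set K := ‖S'‖ + 1 with hK
  have hK0 : 0 < K := by positivity
  have hKc : (K : ℂ) ≠ 0 := by exact_mod_cast hK0.ne'
  have hM := fun α => norm_monomial_pos (m := m) hr α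
  refine exists_isNuclearRepr_of_countable (ι := Fin m → ℕ) hp
    (c := fun α => (ρ : ℂ) ^ (∑ i, α i) * K) (l := fun α => (‖monomial r α‖ : ℂ) • L α)
    (v := fun α => ((K : ℂ)⁻¹ * (‖monomial r α‖ : ℂ)⁻¹) • S' (monomial r α))
    (fun α => ?_) (fun α => ?_) ?_ fun f => ?_
  · rw [norm_smul, Complex.norm_real, norm_norm, ← le_div_iff₀' (hM α), one_div]
    exact hLn α
  · rw [norm_smul, norm_mul, norm_inv, norm_inv, Complex.norm_real, Complex.norm_real, norm_norm,
      Real.norm_of_nonneg hK0.le, mul_assoc, inv_mul_le_iff₀ hK0, inv_mul_le_iff₀ (hM α), mul_one,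
      mul_comm]
    refine (S'.le_opNorm _).trans ?_
    gcongr
    rw [hK]; linarith
  · have h3 : ∀ α : Fin m → ℕ, ‖(ρ : ℂ) ^ (∑ i, α i) * K‖ ^ p = (ρ ^ p) ^ (∑ i, α i) * K ^ p := by
      intro α
      rw [norm_mul, norm_pow, Complex.norm_real, Complex.norm_real, Real.norm_of_nonneg hK0.le,
        Real.norm_of_nonneg h0.le, Real.mul_rpow (by positivity) hK0.le, ← Real.rpow_natCast,
        ← Real.rpow_mul h0.le, mul_comm _ p, Real.rpow_mul h0.le, Real.rpow_natCast]
    simp only [h3]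
    exact (summable_pow_sum m (by positivity) (Real.rpow_lt_one h0.le hρ1 hp)).mul_right _
  · rw [hcomp]
    refine ((hasSum_dilation hr h0 hρ1 hD f).mapL S').congr_fun fun α => ?_
    have : (‖monomial r α‖ : ℂ) ≠ 0 := by exact_mod_cast (hM α).ne'
    rw [map_smul, smul_smul, smul_apply, hL, smul_eq_mul]
    congr 1
    field_simp

/-- The sum of the dilated trace terms of a nuclear representation. -/
theorem tsum_dilation_trace (hr : 0 < r)
    {S : AInfty (ball (0 : Cn m) r) →L[ℂ] AInfty (ball (0 : Cn m) r)} {c : ℕ → ℂ}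
    {l : ℕ → AInfty (ball (0 : Cn m) r) →L[ℂ] ℂ} {v : ℕ → AInfty (ball (0 : Cn m) r)}
    (h : IsNuclearRepr 1 S c l v) {ρ : ℝ} (h0 : 0 < ρ) (h1 : ρ < 1)
    {D : AInfty (ball (0 : Cn m) r) →L[ℂ] AInfty (ball (0 : Cn m) r)}
    (hD : ∀ f (z : closure (ball (0 : Cn m) r)), (D f).1 z = extend f ((ρ : ℂ) • (z : Cn m))) :
    ∑' n, c n * l n (D (v n)) =
      ∑' α : Fin m → ℕ, (ρ : ℂ) ^ (∑ i, α i) * taylorCoeff r α (extend (S (monomial r α))) := by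
  choose L hL hLn using exists_coeffFunctional (m := m) hr
  have hM := fun α => norm_monomial_pos (m := m) hr α
  have hc : Summable fun n => ‖c n‖ := by simpa using h.summable
  -- Summing first over `α` reassembles the dilation of `v n`; summing first over `n` reassembles `S
  -- (monomial r α)`. The bounds on `L` and on the monomial cancel, leaving the summable majorant
  -- `‖c n‖ * ρ ^ |α|`.
  let g : ℕ × (Fin m → ℕ) → ℂ := fun p =>
    c p.1 * ((ρ : ℂ) ^ (∑ i, p.2 i) * L p.2 (v p.1) * l p.1 (monomial r p.2))
  have hbdd : Summable fun p : ℕ × (Fin m → ℕ) => ‖c p.1‖ * ρ ^ ∑ i, p.2 i :=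
    Summable.mul_of_nonneg (f := fun n => ‖c n‖) (g := fun α : Fin m → ℕ => ρ ^ ∑ i, α i) hc
      (summable_pow_sum m h0.le h1) (fun n => norm_nonneg (c n)) fun α => pow_nonneg h0.le _
  have hg : Summable g := by
    refine Summable.of_norm_bounded hbdd fun p => ?_
    simp only [g, norm_mul, norm_pow, Complex.norm_real, Real.norm_of_nonneg h0.le]
    refine mul_le_mul_of_nonneg_left ?_ (norm_nonneg _)
    rw [mul_assoc]
    refine mul_le_of_le_one_right (pow_nonneg h0.le _) ?_
    have h2 : ‖L p.2 (v p.1)‖ ≤ ‖monomial r p.2‖⁻¹ := by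
      refine ((L p.2).le_opNorm _).trans ?_
      exact (mul_le_mul (hLn p.2) (h.norm_vector_le p.1) (norm_nonneg _) (by positivity)).trans_eq
        (mul_one _)
    have h3 : ‖l p.1 (monomial r p.2)‖ ≤ ‖monomial r p.2‖ := by
      refine ((l p.1).le_opNorm _).trans ?_
      exact mul_le_of_le_one_left (norm_nonneg _) (h.norm_functional_le p.1)
    refine (mul_le_mul h2 h3 (norm_nonneg _) (by positivity)).trans_eq ?_
    exact inv_mul_cancel₀ (hM p.2).ne'
  have hleft : ∀ n, ∑' α, g (n, α) = c n * l n (D (v n)) := fun n => by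
    refine HasSum.tsum_eq (HasSum.mul_left _ ?_)
    refine ((hasSum_dilation hr h0 h1 hD (v n)).mapL (l n)).congr_fun fun α => ?_
    rw [map_smul, smul_eq_mul, hL]
  have hright : ∀ α, ∑' n, g (n, α) =
      (ρ : ℂ) ^ (∑ i, α i) * taylorCoeff r α (extend (S (monomial r α))) := fun α => by
    refine HasSum.tsum_eq ?_
    rw [← hL]
    refine (((h.hasSum (monomial r α)).mapL (L α)).mul_left ((ρ : ℂ) ^ (∑ i, α i))).congr_fun
      fun n => ?_
    rw [map_smul, smul_eq_mul]
    simp only [g]; ring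
  simp only [← hleft, ← hright]
  exact (Summable.tsum_comm (f := fun n α => g (n, α)) hg).symm

end Ball

end AInfty

/-! ### The limit of vanishing dilation and the nuclear trace. -/

section Continuity

variable {m : ℕ}

theorem det_ne_zero_of_isUnit {L : Cn m →L[ℂ] Cn m} (h : IsUnit L) : L.det ≠ 0 := by
  intro h0
  have h1 := congrArg (fun L : Cn m →L[ℂ] Cn m => LinearMap.det (L : Cn m →ₗ[ℂ] Cn m))
    (Ring.mul_inverse_cancel L h)
  have h2 : LinearMap.det (L : Cn m →ₗ[ℂ] Cn m) *
      LinearMap.det ((Ring.inverse L : Cn m →L[ℂ] Cn m) : Cn m →ₗ[ℂ] Cn m) = 1 := by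
    rw [← map_mul]
    exact h1.trans LinearMap.det_id
  rw [ContinuousLinearMap.det] at h0
  rw [h0, zero_mul] at h2
  exact zero_ne_one h2

theorem tendsto_fixedPoint_trace {A : Cn m →L[ℂ] Cn m} (hA : ‖A‖ < 1) (b : Cn m) {φ : Cn m → ℂ}
    (hφ : Continuous φ) {ρ : ℕ → ℝ} (hρ : Tendsto ρ atTop (𝓝 1)) :
    Tendsto (fun k => φ (Ring.inverse (1 - (ρ k : ℂ) • A) ((ρ k : ℂ) • b)) /
      (1 - (ρ k : ℂ) • A).det) atTop (𝓝 (φ (Ring.inverse (1 - A) b) / (1 - A).det)) := by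
  have hu := isUnit_one_sub_of_norm_lt_one hA
  have hρc : Tendsto (fun k => (ρ k : ℂ)) atTop (𝓝 1) :=
    (Complex.continuous_ofReal.tendsto 1).comp hρ
  have h1 : Tendsto (fun k => 1 - (ρ k : ℂ) • A) atTop (𝓝 (1 - A)) := by
    simpa using (hρc.smul_const A).const_sub 1
  have h2 : Tendsto (fun k => (ρ k : ℂ) • b) atTop (𝓝 b) := by
    simpa using hρc.smul_const b
  have h3 : Tendsto (fun k => Ring.inverse (1 - (ρ k : ℂ) • A)) atTop
      (𝓝 (Ring.inverse (1 - A))) := by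
    obtain ⟨u, hu⟩ := hu
    rw [← hu] at h1 ⊢
    exact (NormedRing.inverse_continuousAt u).tendsto.comp h1
  refine Tendsto.div ((hφ.tendsto _).comp
    ((isBoundedBilinearMap_apply.continuous.tendsto (Ring.inverse (1 - A), b)).comp
      (h3.prodMk_nhds h2))) ?_ (det_ne_zero_of_isUnit hu)
  exact (ContinuousLinearMap.continuous_det.tendsto (1 - A)).comp h1

end Continuity

namespace AInfty

variable {m : ℕ} {r : ℝ}

/-- For `ρ < 1` the dilated trace is independent of the representation and equals the Fock trace for
`ρ A` and `ρ b`. Both sides converge as `ρ → 1`, the left one by dominated convergence with majorant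
`‖c n‖`. -/
theorem hasNuclearTrace_weightedComp (hr : 0 < r) {A : Cn m →L[ℂ] Cn m} (hA : ‖A‖ < 1) {b : Cn m}
    (hAb : ‖A‖ * r + ‖b‖ < r) {φ : Cn m → ℂ} (hφ : Differentiable ℂ φ) {C a : ℝ}
    (hbound : ∀ z, ‖φ z‖ ≤ C * Real.exp (a * ‖z‖))
    {S : AInfty (ball (0 : Cn m) r) →L[ℂ] AInfty (ball (0 : Cn m) r)}
    (hS : ∀ f (z : closure (ball (0 : Cn m) r)), (S f).1 z = φ z * extend f (A z + b)) :
    HasNuclearTrace S (φ (Ring.inverse (1 - A) b) / (1 - A).det) := by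
  refine ⟨isNuclearOfOrderZero_weightedComp hr hAb hφ hS 1 one_pos, fun c l v h => ?_⟩
  have hc : Summable fun n => ‖c n‖ := by simpa using h.summable
  have hlv : ∀ n w, ‖w‖ ≤ 1 → ‖c n * l n w‖ ≤ ‖c n‖ := fun n w hw => by
    rw [norm_mul]
    refine mul_le_of_le_one_right (norm_nonneg _) (((l n).le_opNorm _).trans ?_)
    exact mul_le_one₀ (h.norm_functional_le n) (norm_nonneg _) hw
  have hsum : Summable fun n => c n * l n (v n) :=
    Summable.of_norm_bounded hc fun n => hlv n _ (h.norm_vector_le n)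
  -- The `+ 2` keeps `ρ 0` positive.
  let ρ : ℕ → ℝ := fun k => 1 - 1 / ((k : ℝ) + 2)
  have h0 : ∀ k, 0 < ρ k := fun k => by
    have : 1 / ((k : ℝ) + 2) < 1 := by
      rw [div_lt_one (by positivity)]
      linarith [k.cast_nonneg (α := ℝ)]
    simp only [ρ]; linarith
  have h1 : ∀ k, ρ k < 1 := fun k => by
    have : 0 < 1 / ((k : ℝ) + 2) := by positivity
    simp only [ρ]; linarith
  have hρ : Tendsto ρ atTop (𝓝 1) := by
    have : Tendsto (fun k : ℕ => 1 / ((k : ℝ) + 2)) atTop (𝓝 0) :=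
      tendsto_const_nhds.div_atTop (tendsto_atTop_add_const_right _ _ tendsto_natCast_atTop_atTop)
    have h := this.const_sub 1
    rwa [sub_zero] at h
  choose D hD using fun k => exists_dilation (m := m) hr (h0 k) (h1 k)
  have hmap : ∀ z : Cn m, ‖z‖ ≤ r → ‖A z + b‖ < r := fun z hz =>
    lt_of_le_of_lt ((norm_add_le _ _).trans
      (add_le_add_left ((A.le_opNorm z).trans (by gcongr)) _)) hAb
  have hval : ∀ k, ∑' n, c n * l n (D k (v n)) =
      φ (Ring.inverse (1 - (ρ k : ℂ) • A) ((ρ k : ℂ) • b)) / (1 - (ρ k : ℂ) • A).det := by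
    intro k
    have hAk : ‖(ρ k : ℂ) • A‖ < 1 := by
      rw [norm_smul, Complex.norm_real, Real.norm_of_nonneg (h0 k).le]
      nlinarith [h0 k, h1 k, norm_nonneg A]
    rw [tsum_dilation_trace hr h (h0 k) (h1 k) (hD k)]
    refine HasSum.tsum_eq ((hasSum_taylorCoeff_weightedComp hr hAk ((ρ k : ℂ) • b) hφ
      hbound).congr_fun fun α => ?_)
    -- By homogeneity the factor `ρ ^ |α|` is absorbed into the monomial, turning `A z + b` into `ρ
    -- A z + ρ b`.
    rw [← taylorCoeff_const_mul]
    refine taylorCoeff_congr hr α fun z hz => ?_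
    have hzc : z ∈ closure (ball (0 : Cn m) r) := (mem_closure_ball hr).2 hz.le
    have hψ : A z + b ∈ closure (ball (0 : Cn m) r) := (mem_closure_ball hr).2 (hmap z hz.le).le
    rw [extend_coe (S (monomial r α)) ⟨z, hzc⟩, hS, extend_coe (monomial r α) ⟨_, hψ⟩,
      monomial_apply, smul_apply, ← smul_add, monomialFun_smul]
    ring
  have hlim1 : Tendsto (fun k => ∑' n, c n * l n (D k (v n))) atTop
      (𝓝 (∑' n, c n * l n (v n))) := by
    refine tendsto_tsum_of_dominated_convergence hc (fun n => ?_)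
      (Eventually.of_forall fun k n => ?_)
    · exact (((l n).continuous.tendsto _).comp
        (tendsto_dilation hr h0 h1 hρ hD (v n))).const_mul _
    · refine hlv n _ (norm_le_of_forall zero_le_one fun z => ?_)
      rw [hD]
      refine (norm_extend_le (v n) ((mem_closure_ball hr).2 ?_)).trans (h.norm_vector_le n)
      have := (mem_closure_ball hr).1 z.2
      rw [norm_smul, Complex.norm_real, Real.norm_of_nonneg (h0 k).le]
      nlinarith [h1 k, norm_nonneg (z : Cn m)]
  simp only [hval] at hlim1
  rw [tendsto_nhds_unique (tendsto_fixedPoint_trace hA b hφ.continuous hρ) hlim1]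
  exact hsum.hasSum

end AInfty

theorem theorem4p3 (m : ℕ) (A : Cn m →L[ℂ] Cn m) (hA : ‖A‖ < 1) (b : Cn m)
    (φ : Cn m → ℂ) (hφ : Differentiable ℂ φ)
    (a c : ℝ) (hbound : ∀ z, ‖φ z‖ ≤ c * Real.exp (a * ‖z‖)) :
    (∃ T : BargmannFock m →L[ℂ] BargmannFock m,
      (∀ (f : BargmannFock m) (z : Cn m), T f z = φ z * f (A z + b)) ∧
      IsTraceClass T ∧
      HasHilbertTrace T (φ (Ring.inverse (1 - A) b) / (1 - A).det)) ∧
    ∀ r : ℝ, ‖b‖ / (1 - ‖A‖) < r →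
      ∃ hψ : ∀ z ∈ closure (ball (0 : Cn m) r), A z + b ∈ ball (0 : Cn m) r,
      ∃ S : AInfty (ball (0 : Cn m) r) →L[ℂ] AInfty (ball (0 : Cn m) r),
        (∀ (f : AInfty (ball (0 : Cn m) r)) (z : closure (ball (0 : Cn m) r)),
          (S f).1 z = φ z * f.1 ⟨A z + b, subset_closure (hψ z z.2)⟩) ∧
        IsNuclearOfOrderZero S ∧
        HasNuclearTrace S (φ (Ring.inverse (1 - A) b) / (1 - A).det) := by
  constructor
  · obtain ⟨T, hT⟩ := exists_weightedComp hA b hφ hbound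
    exact ⟨T, hT, isTraceClass_weightedComp hA hφ hbound hT,
      hasHilbertTrace_weightedComp hA hφ hbound hT⟩
  · intro r hbr
    have hA1 : 0 < 1 - ‖A‖ := sub_pos.2 hA
    have hr : 0 < r := lt_of_le_of_lt (by positivity) hbr
    have hAb : ‖A‖ * r + ‖b‖ < r := by
      rw [div_lt_iff₀ hA1] at hbr
      linarith
    have hψ : ∀ z ∈ closure (ball (0 : Cn m) r), A z + b ∈ ball (0 : Cn m) r := by
      intro z hz
      rw [AInfty.mem_closure_ball hr] at hz
      rw [mem_ball_zero_iff]
      exact lt_of_le_of_lt ((norm_add_le _ _).trans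
        (add_le_add_left ((A.le_opNorm z).trans (by gcongr)) _)) hAb
    obtain ⟨S, hS⟩ := AInfty.exists_weightedComp (U := ball (0 : Cn m) r) isBounded_ball hφ
      (ψ := fun z => A z + b) (by fun_prop) hψ
    exact ⟨hψ, S, fun f z => by rw [hS, AInfty.extend_coe f ⟨_, subset_closure (hψ z z.2)⟩],
      AInfty.isNuclearOfOrderZero_weightedComp hr hAb hφ hS,
      AInfty.hasNuclearTrace_weightedComp hr hA hAb hφ hbound hS⟩
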